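/- Let $b$ be a prime, let $\mathbb N=\{1,2,\dots\}$ and let $\alpha\ge 2$ be an integer. For $x\in[0,1)$ let $(\mathsf x_\ell)_{\ell\ge1}$ be the digits of its base-$b$ expansion $x=\sum_{\ell\ge1}\mathsf x_\ell b^{-\ell}$ that does not end in an infinite trail of digits $b-1$. For $x,y\in[0,1)$ let $x\oplus y=\sum_{\ell\ge1}\big((\mathsf x_\ell+\mathsf y_\ell)\bmod b\big)b^{-\ell}$, and let $x\ominus y$ be the digit sequence $\big((\mathsf x_\ell-\mathsf y_\ell)\bmod b\big)_{\ell\ge1}$. For $k=\sum_{\ell\ge0}\mathsf k_\ell b^\ell\in\mathbb N$ and a digit sequence $d=(d_\ell)_{\ell\ge1}$ put $\mathrm{wal}_k(d)=\exp\big(\tfrac{2\pi\sqrt{-1}}{b}\sum_{\ell\ge0}\mathsf k_\ell d_{\ell+1}\big)$. If the nonzero base-$b$ digits of $k$ are at the positions $a_1>\dots>a_{\#k}\ge0$ (the position of the digit multiplying $b^a$ being $a$), put $$\mathring\mu_\alpha(k)=\sum_{\ell=1}^{\min(\alpha,\#k)}(a_\ell+1)+\max(\alpha-\#k,0)\,(a_{\#k}+1).$$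 Consider the following kernels on $[0,1)\times[0,1)$: $$\widetilde K_\alpha(x,x')=\sum_{k\in\mathbb Z\setminus\{0\}}k^{-2\alpha}\cos(2\pi k(x-x')),\qquad \widetilde K_\alpha^{\mathrm{DSI}}(x,x')=\int_0^1\widetilde K_\alpha(x\oplus\sigma,x'\oplus\sigma)\,\mathrm d\sigma,$$ $$\mathring K_\alpha(x,x')=\sum_{k\in\mathbb N}b^{-2\mathring\mu_\alpha(k)}\,\mathrm{wal}_k(x\ominus x'),\qquad \mathring{\mathring K}_\alpha(x,x')=\sum_{k\in\mathbb N}b^{-\mathring\mu_\alpha(k)}\,\mathrm{wal}_k(x\ominus x').$$ (In the integral, $\widetilde K_\alpha$ is given by the same formula on $[0,1]\times[0,1]$.) The two Walsh series converge absolutely for all $x,x'\in[0,1)$ and have real sums, and all four kernels are symmetric positive semi-definite. Denoting by $H(K)$ the set of functions $[0,1)\to\mathbb R$ in the real reproducing kernel Hilbert space with kernel $K$, we have $$H\big(\widetilde K_\alpha^{\mathrm{DSI}}\big)\subseteq H\big(\mathring K_\alpha\big)\subseteq H\big(\mathring{\mathring K}_\alpha\big)\qquad\text{and}\qquad H\big(\widetilde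 K_\alpha\big)\subseteq H\big(\mathring{\mathring K}_\alpha\big).$$ -/

import Mathlib

noncomputable section

namespace WalshRKHS

/-! ### Reproducing kernel Hilbert spaces as sets of functions -/

/-- The set of functions `H(K)`: all functions belonging to a real Hilbert space of functions on `X`
with continuous point evaluations whose reproducing kernel is `K`. For a symmetric positive
semi-definite `K` such a Hilbert space exists and is unique (Moore–Aronszajn). -/
def rkhs {X : Type} (K : X → X → ℝ) : Set (X → ℝ) :=
  {f | ∃ (H : Type) (_ : NormedAddCommGroup H) (_ : InnerProductSpace ℝ H) (_ : CompleteSpace H)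
      (_ : RKHS ℝ H X ℝ), (∀ x y, RKHS.kernel H x y 1 = K x y) ∧ ∃ g : H, ⇑g = f}

/-- The half-open unit interval `[0,1)`. -/
abbrev I : Type := Set.Ico (0 : ℝ) 1

/-- The restriction of a kernel to `[0,1) × [0,1)`. -/
def onI (K : ℝ → ℝ → ℝ) : I → I → ℝ := fun x y => K x y

/-- Symmetric and positive semi-definite as a kernel on `[0,1)`. -/
def IsSPSD (K : ℝ → ℝ → ℝ) : Prop := (Matrix.of (onI K)).PosSemidef

/-- The set of functions `[0,1) → ℝ` in the reproducing kernel Hilbert space of `K` on `[0,1)`. -/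
def H (K : ℝ → ℝ → ℝ) : Set (I → ℝ) := rkhs (onI K)

/-! ### Base-`b` digits, digital shifts and Walsh functions -/

/-- Digit-wise addition modulo `b` of the base-`b` expansions of two points of `[0,1)`. -/
def digitAdd (b : ℕ) [NeZero b] (x y : ℝ) : ℝ :=
  Real.ofDigits (Real.digits x b + Real.digits y b)

/-- Digit-wise subtraction modulo `b`. The result is kept as a digit sequence and not collapsed to a
real number: it may end in an infinite trail of the digit `b - 1`, and the Walsh functions are
characters of the group of digit sequences. -/
def digitSub (b : ℕ) [NeZero b] (x y : ℝ) : ℕ → Fin b :=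
  Real.digits x b - Real.digits y b

/-- The digit of `k` at `b ^ a`. -/
def natDigit (b k a : ℕ) : ℕ := k / b ^ a % b

/-- The `k`-th base-`b` Walsh function, as a function of the digits `d 0, d 1, …` after the radix
point. All digits of `k` at positions `≥ k` vanish when `2 ≤ b`. -/
def wal (b k : ℕ) (d : ℕ → Fin b) : ℂ :=
  Complex.exp (2 * Real.pi * Complex.I / b *
    ((∑ l ∈ Finset.range k, natDigit b k l * (d l : ℕ) : ℕ) : ℂ))

/-! ### Dick weights -/

/-- For `k = ∑ₗ 𝗄_{aₗ} b ^ aₗ` with `a₁ > ⋯ > a_{#k}` and nonzero digits `𝗄_{aₗ}`, the list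
`[a₁ + 1, …, a_{#k} + 1]` (empty for `k = 0`). -/
def positions (b k : ℕ) : List ℕ :=
  ((List.range k).reverse.filter fun a => natDigit b k a ≠ 0).map (· + 1)

/-- `μ_α(k) = ∑_{ℓ = 1}^{min(α, #k)} (aₗ + 1)`. -/
def mu (b α k : ℕ) : ℕ := ((positions b k).take α).sum

/-- `μ̊_α(k) = μ_α(k) + max(α - #k, 0) (a_{#k} + 1)`, equal to `0` for `k = 0`
(natural-number subtraction is the maximum with `0`). -/
def muRing (b α k : ℕ) : ℕ :=
  mu b α k + (α - (positions b k).length) * (positions b k).getLastD 0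

/-! ### Kernels -/

/-- The Korobov kernel `K̃_α(x, x') = ∑_{k ∈ ℤ \ {0}} k ^ (-2α) cos(2πk(x - x'))`. -/
def korobov (α : ℕ) (x x' : ℝ) : ℝ :=
  ∑' k : {k : ℤ // k ≠ 0}, ((k : ℝ) ^ (2 * α))⁻¹ * Real.cos (2 * Real.pi * k * (x - x'))

/-- The digitally-shift-invariant kernel associated with `K`:
`K^DSI(x, x') = ∫₀¹ K(x ⊕ σ, x' ⊕ σ) dσ`. -/
def dsi (b : ℕ) [NeZero b] (K : ℝ → ℝ → ℝ) (x x' : ℝ) : ℝ :=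
  ∫ σ in (0 : ℝ)..1, K (digitAdd b x σ) (digitAdd b x' σ)

/-- The term `r²(k) wal_k(x ⊖ x')` of a Walsh kernel, for `k` in the positive integers. -/
def walshTerm (b : ℕ) [NeZero b] (r2 : ℕ → ℝ) (x x' : ℝ) (k : ℕ+) : ℂ :=
  (r2 k : ℂ) * wal b k (digitSub b x x')

/-- The Walsh kernel `K(x, x') = ∑_{k ≥ 1} r²(k) wal_k(x ⊖ x')` with weights `r²`. It is used only
for weights for which the series converges to a real number. -/
def walshKernel (b : ℕ) [NeZero b] (r2 : ℕ → ℝ) (x x' : ℝ) : ℝ :=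
  (∑' k : ℕ+, walshTerm b r2 x x' k).re

/-- `r̊_α²(k) = b ^ (-2 μ̊_α(k))`. -/
def rRing2 (b α k : ℕ) : ℝ := ((b : ℝ) ^ (2 * muRing b α k))⁻¹

/-- `r̊̊_α²(k) = b ^ (-μ̊_α(k))`. -/
def rRingRing2 (b α k : ℕ) : ℝ := ((b : ℝ) ^ muRing b α k)⁻¹

/-- `K̊_α`. -/
def kRing (b : ℕ) [NeZero b] (α : ℕ) : ℝ → ℝ → ℝ := walshKernel b (rRing2 b α)

/-- `K̊̊_α`. -/
def kRingRing (b : ℕ) [NeZero b] (α : ℕ) : ℝ → ℝ → ℝ := walshKernel b (rRingRing2 b α)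

end WalshRKHS

end

/-!
By Aronszajn's criterion `H(K₁) ⊆ H(K₂)` follows from an inequality `Q₁ ≤ C Q₂` between the
quadratic forms `Q(a) = ∑ a(x) a(y) K(x, y)` of the two kernels. The form of a Walsh kernel is
`∑ r²(k) |W(k)|²` with `W(k) = ∑ a(x) wal_k(x)`, and that of the Korobov kernel is
`∑ h ^ (-2α) |∑ a(x) exp(2πihx)|²`.

After truncation of the points to `n` digits, `exp(2πihx)` is a Walsh polynomial with frequencies
`k < b ^ n`, and its coefficients `c_h(k)` factor over the digits of `k`. The factors are Dirichlet
means, small at the nonzero digits, so that `|c_h(k)|` is at most of order `|h| ^ α b ^ (-μ̊(k))`.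
Moreover `c_h(k)` depends on `h` only modulo `b ^ n` and `∑_h |c_h(k)|² = 1` over a period, whence
`∑_h h ^ (-2α) |c_h(k)|²` is at most of order `b ^ (-2μ̊(k))`. Averaging over the digital shifts
diagonalizes the truncated Korobov form in the `W(k)`, with exactly these sums as weights. Without
the average, the Cauchy–Schwarz inequality bounds it by a form with weights `b ^ (-μ̊(k))`, at the
cost of the factor `∑ b ^ (-μ̊(k))`. Then `n → ∞`.
-/

noncomputable section

namespace WalshRKHS

open Filter Topology MeasureTheory
open scoped InnerProductSpace ComplexConjugate

/-! ### Quadratic forms of kernels and Aronszajn's inclusion criterion -/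

section Kernels

variable {X : Type*}

/-- The quadratic form `∑ₓ ∑_y aₓ a_y K(x, y)` of a kernel, for finitely supported coefficients. -/
def quadForm (K : X → X → ℝ) (a : X →₀ ℝ) : ℝ :=
  ∑ x ∈ a.support, ∑ y ∈ a.support, a x * a y * K x y

/-- The value `∑ₓ aₓ u(x)` at `u` of the finitely supported signed measure `a`. -/
def pairing (a : X →₀ ℝ) (u : X → ℂ) : ℂ :=
  ∑ x ∈ a.support, (a x : ℂ) * u x

theorem posSemidef_iff_quadForm_nonneg {K : X → X → ℝ} :
    (Matrix.of K).PosSemidef ↔ (∀ x y, K x y = K y x) ∧ ∀ a, 0 ≤ quadForm K a := by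
  have hsymm : (Matrix.of K).IsHermitian ↔ ∀ x y, K x y = K y x := by
    simp only [Matrix.IsHermitian.ext_iff, Matrix.of_apply, star_trivial]
    exact ⟨fun h x y => h y x, fun h x y => h y x⟩
  have hform (a : X →₀ ℝ) : quadForm K a =
      a.sum fun x s => a.sum fun y t => star s * Matrix.of K x y * t := by
    simp only [quadForm, Finsupp.sum, Matrix.of_apply, star_trivial, mul_right_comm]
  simp only [Matrix.PosSemidef, hsymm, hform]

theorem quadForm_const_mul (c : ℝ) (K : X → X → ℝ) (a : X →₀ ℝ) :
    quadForm (fun x y => c * K x y) a = c * quadForm K a := by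
  simp only [quadForm, Finset.mul_sum]
  exact Finset.sum_congr rfl fun x _ => Finset.sum_congr rfl fun y _ => by ring

theorem quadForm_sum {ι : Type*} (s : Finset ι) (K : ι → X → X → ℝ) (a : X →₀ ℝ) :
    quadForm (fun x y => ∑ i ∈ s, K i x y) a = ∑ i ∈ s, quadForm (K i) a := by
  simp only [quadForm, Finset.mul_sum]
  exact (Finset.sum_congr rfl fun x _ => Finset.sum_comm).trans Finset.sum_comm

theorem tendsto_quadForm {ι : Type*} {l : Filter ι} {K : ι → X → X → ℝ} {K' : X → X → ℝ}
    (h : ∀ x y, Tendsto (fun i => K i x y) l (𝓝 (K' x y))) (a : X →₀ ℝ) :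
    Tendsto (fun i => quadForm (K i) a) l (𝓝 (quadForm K' a)) :=
  tendsto_finsetSum _ fun x _ => tendsto_finsetSum _ fun y _ => (h x y).const_mul _

theorem pairing_sum {ι : Type*} (s : Finset ι) (c : ι → ℂ) (u : ι → X → ℂ) (a : X →₀ ℝ) :
    pairing a (fun x => ∑ i ∈ s, c i * u i x) = ∑ i ∈ s, c i * pairing a (u i) := by
  simp only [pairing, Finset.mul_sum]
  rw [Finset.sum_comm]
  exact Finset.sum_congr rfl fun i _ => Finset.sum_congr rfl fun x _ => by ring

theorem quadForm_re_mul_conj (u : X → ℂ) (a : X →₀ ℝ) :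
    quadForm (fun x y => (u x * conj (u y)).re) a = ‖pairing a u‖ ^ 2 := by
  have hsq : ((‖pairing a u‖ ^ 2 : ℝ) : ℂ) = pairing a u * conj (pairing a u) := by
    rw [Complex.mul_conj, Complex.normSq_eq_norm_sq]
  rw [← Complex.ofReal_re (‖pairing a u‖ ^ 2), hsq]
  simp only [quadForm, pairing, map_sum, map_mul, Complex.conj_ofReal, Finset.sum_mul_sum,
    Complex.re_sum]
  refine Finset.sum_congr rfl fun x _ => Finset.sum_congr rfl fun y _ => ?_
  rw [mul_mul_mul_comm, ← Complex.ofReal_mul, Complex.re_ofReal_mul]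

section HasSum

variable {ι : Type*} {w : ι → ℝ} {u : ι → X → ℂ} {K : X → X → ℝ}

theorem hasSum_quadForm (h : ∀ x y, HasSum (fun i => w i * (u i x * conj (u i y)).re) (K x y))
    (a : X →₀ ℝ) : HasSum (fun i => w i * ‖pairing a (u i)‖ ^ 2) (quadForm K a) := by
  simp only [← quadForm_re_mul_conj, ← quadForm_const_mul]
  exact hasSum_sum fun x _ => hasSum_sum fun y _ => (h x y).mul_left _

theorem posSemidef_of_hasSum (hw : ∀ i, 0 ≤ w i)
    (h : ∀ x y, HasSum (fun i => w i * (u i x * conj (u i y)).re) (K x y)) :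
    (Matrix.of K).PosSemidef := by
  refine posSemidef_iff_quadForm_nonneg.mpr ⟨fun x y => (h x y).unique ?_, fun a =>
    (hasSum_quadForm h a).nonneg fun i => mul_nonneg (hw i) (sq_nonneg _)⟩
  convert h y x using 3 with i
  simp only [Complex.mul_re, Complex.conj_re, Complex.conj_im]
  ring

end HasSum

end Kernels

theorem exists_rkhs_of_posSemidef {X : Type} {K : X → X → ℝ} (hK : (Matrix.of K).PosSemidef) :
    ∃ (H : Type) (_ : NormedAddCommGroup H) (_ : InnerProductSpace ℝ H) (_ : CompleteSpace H)
      (_ : RKHS ℝ H X ℝ), ∀ x y, RKHS.kernel H x y 1 = K x y := by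
  obtain ⟨hsymm, hnonneg⟩ := posSemidef_iff_quadForm_nonneg.mp hK
  let M : Matrix X X (ℝ →L[ℝ] ℝ) := .of fun x y => K x y • ContinuousLinearMap.id ℝ ℝ
  have hM : M.PosSemidef := by
    have hiff := (RKHS.posSemidef_tfae (K := M)).out 0 2
    refine hiff.mpr ⟨?_, fun v => ?_⟩
    · ext x y
      have : star (ContinuousLinearMap.id ℝ ℝ) = ContinuousLinearMap.id ℝ ℝ :=
        star_one (ℝ →L[ℝ] ℝ)
      simp [M, hsymm x y, this]
    · convert hnonneg v using 1
      refine Finset.sum_congr rfl fun x _ => Finset.sum_congr rfl fun y _ => ?_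
      simp only [Matrix.of_apply, smul_apply, ContinuousLinearMap.id_apply, smul_eq_mul,
        RCLike.inner_apply, Real.ringHom_apply, hsymm x y, M]
      ring
  have : Fact M.PosSemidef := ⟨hM⟩
  refine ⟨RKHS.OfKernel M, inferInstance, inferInstance, inferInstance, inferInstance, ?_⟩
  intro x y
  simp [RKHS.OfKernel.kernel_ofKernel, M]

section KerComb

variable {X : Type*} {H : Type*} [NormedAddCommGroup H] [InnerProductSpace ℝ H] [CompleteSpace H]
  [RKHS ℝ H X ℝ]

variable (H) in
/-- The finite linear combination of kernel functions `∑ₓ aₓ K(·, x)`. -/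
def kerComb : (X →₀ ℝ) →ₗ[ℝ] H := Finsupp.linearCombination ℝ fun x => RKHS.kerFun H x 1

theorem inner_kerComb (g : H) (a : X →₀ ℝ) :
    ⟪g, kerComb H a⟫_ℝ = ∑ x ∈ a.support, a x * g x := by
  simp [kerComb, Finsupp.linearCombination_apply, Finsupp.sum, inner_sum, inner_smul_right]

theorem norm_kerComb_sq {K : X → X → ℝ} (hK : ∀ x y, RKHS.kernel H x y 1 = K x y) (a : X →₀ ℝ) :
    ‖kerComb H a‖ ^ 2 = quadForm K a := by
  have happly (x : X) : kerComb H a x = ∑ y ∈ a.support, a y * K x y := by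
    rw [kerComb, Finsupp.linearCombination_apply, Finsupp.sum, ← RKHS.coeCLM_apply (𝕜 := ℝ),
      map_sum, Finset.sum_apply]
    refine Finset.sum_congr rfl fun y _ => ?_
    rw [← hK, ← RKHS.kerFun_apply]
    simp
  simp only [← real_inner_self_eq_norm_sq, inner_kerComb, happly, quadForm, Finset.mul_sum,
    mul_assoc]

variable (H) in
theorem denseRange_kerComb : DenseRange (kerComb H : (X →₀ ℝ) → H) := by
  have hspan : Submodule.span ℝ {RKHS.kerFun H x v | (x : X) (v : ℝ)} ≤
      LinearMap.range (kerComb (X := X) H) := by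
    rw [Submodule.span_le]
    rintro _ ⟨x, v, rfl⟩
    exact ⟨Finsupp.single x v, by simp [kerComb, ← map_smul]⟩
  rw [DenseRange, ← LinearMap.coe_range, Submodule.dense_iff_topologicalClosure_eq_top]
  exact top_le_iff.mp ((RKHS.kerFun_dense (𝕜 := ℝ) (V := ℝ) (X := X) H) ▸
    Submodule.topologicalClosure_mono hspan)

end KerComb

theorem rkhs_subset_of_quadForm_le {X : Type} {K₁ K₂ : X → X → ℝ}
    (hK₂ : (Matrix.of K₂).PosSemidef) {C : ℝ} (hC : 0 ≤ C)
    (hle : ∀ a, quadForm K₁ a ≤ C * quadForm K₂ a) : rkhs K₁ ⊆ rkhs K₂ := by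
  rintro f ⟨H₁, _, _, _, _, hker₁, g, rfl⟩
  obtain ⟨H₂, i₁, i₂, i₃, i₄, hker₂⟩ := exists_rkhs_of_posSemidef hK₂
  have hbound (a : X →₀ ℝ) : ‖kerComb H₁ a‖ ≤ √C * ‖kerComb H₂ a‖ := by
    refine (sq_le_sq₀ (norm_nonneg _) (by positivity)).mp ?_
    rw [mul_pow, Real.sq_sqrt hC, norm_kerComb_sq hker₁, norm_kerComb_sq hker₂]
    exact hle a
  -- `K₂(·, x) ↦ K₁(·, x)` extends to a bounded operator; its adjoint is the inclusion.
  let S : H₂ →L[ℝ] H₁ := (kerComb H₁).extendOfNorm (kerComb H₂)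
  have hS (a : X →₀ ℝ) : S (kerComb H₂ a) = kerComb H₁ a :=
    LinearMap.extendOfNorm_eq (denseRange_kerComb H₂) ⟨_, hbound⟩ a
  refine ⟨H₂, i₁, i₂, i₃, i₄, hker₂, S.adjoint g, funext fun x => ?_⟩
  calc S.adjoint g x = ⟪S.adjoint g, kerComb H₂ (Finsupp.single x 1)⟫_ℝ := by simp [kerComb]
    _ = ⟪g, kerComb H₁ (Finsupp.single x 1)⟫_ℝ := by
      rw [ContinuousLinearMap.adjoint_inner_left, hS]
    _ = g x := by simp [kerComb]

/-! ### The exponential character and Dirichlet means -/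

/-- The character `t ↦ exp(2πit)` of the additive group of real numbers. -/
def e : AddChar ℝ ℂ := Circle.coeHom.compAddChar Real.fourierChar

theorem e_apply (t : ℝ) : e t = Complex.exp (↑(2 * Real.pi * t) * Complex.I) :=
  Real.fourierChar_apply t

theorem norm_e (t : ℝ) : ‖e t‖ = 1 := Circle.norm_coe _

theorem conj_e (t : ℝ) : conj (e t) = e (-t) := by
  rw [AddChar.map_neg_eq_inv, Complex.inv_eq_conj (norm_e t)]

theorem re_e (t : ℝ) : (e t).re = Real.cos (2 * Real.pi * t) := by
  rw [e_apply, Complex.exp_ofReal_mul_I_re]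

theorem e_eq_one_iff {t : ℝ} : e t = 1 ↔ ∃ m : ℤ, t = m := by
  rw [e_apply, Complex.exp_eq_one_iff]
  refine exists_congr fun m => ?_
  rw [← mul_assoc, mul_left_inj' Complex.I_ne_zero, mul_comm (m : ℂ)]
  norm_cast
  rw [mul_right_inj' Real.two_pi_pos.ne']

theorem e_add_intCast (t : ℝ) (m : ℤ) : e (t + m) = e t := by
  rw [AddChar.map_add_eq_mul, e_eq_one_iff.mpr ⟨m, rfl⟩, mul_one]

theorem e_sum {ι : Type*} (s : Finset ι) (t : ι → ℝ) : e (∑ i ∈ s, t i) = ∏ i ∈ s, e (t i) := by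
  classical
  induction s using Finset.induction_on with
  | empty => simp
  | insert i s hi ih => rw [Finset.sum_insert hi, Finset.prod_insert hi, e.map_add_eq_mul, ih]

theorem e_natCast_mul (n : ℕ) (t : ℝ) : e (n * t) = e t ^ n := by
  rw [← nsmul_eq_mul, AddChar.map_nsmul_eq_pow]

theorem e_div_eq_of_modEq {b : ℕ} [NeZero b] {m n : ℤ} (h : m ≡ n [ZMOD b]) :
    e (m / b) = e (n / b) := by
  obtain ⟨q, hq⟩ := h.symm.dvd
  rw [← e_add_intCast (n / b) q, eq_add_of_sub_eq' hq]
  push_cast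
  field_simp [NeZero.ne (b : ℝ)]

theorem norm_e_sub_e_le (s t : ℝ) : ‖e s - e t‖ ≤ 2 * Real.pi * |s - t| := by
  calc ‖e s - e t‖ = ‖e (s - t) - 1‖ := by
        rw [← one_mul ‖e (s - t) - 1‖, ← norm_e t, ← norm_mul, mul_sub_one,
          ← AddChar.map_add_eq_mul, add_sub_cancel]
    _ ≤ ‖2 * Real.pi * (s - t)‖ := by
        rw [e_apply, mul_comm]
        exact Real.norm_exp_I_mul_ofReal_sub_one_le
    _ = 2 * Real.pi * |s - t| := by
        rw [norm_mul, Real.norm_of_nonneg Real.two_pi_pos.le, Real.norm_eq_abs]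

theorem sum_range_e_mul_div (b : ℕ) [NeZero b] (m : ℤ) :
    ∑ d ∈ Finset.range b, e (d * m / b) = if (b : ℤ) ∣ m then (b : ℂ) else 0 := by
  have hb : (b : ℝ) ≠ 0 := NeZero.ne _
  have hone : e (m / b) = 1 ↔ (b : ℤ) ∣ m := by
    rw [e_eq_one_iff]
    refine exists_congr fun q => ?_
    rw [div_eq_iff hb, mul_comm]
    norm_cast
  simp only [mul_div_assoc, e_natCast_mul]
  split_ifs with h
  · simp [hone.mpr h]
  · rw [geom_sum_eq (hone.not.mpr h), ← e_natCast_mul, mul_div_cancel₀ _ hb,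
      e_eq_one_iff.mpr ⟨m, rfl⟩, sub_self, zero_div]

theorem sum_range_e_mul_sub_div (b : ℕ) [NeZero b] {x y : ℕ} (hx : x < b) (hy : y < b) :
    ∑ d ∈ Finset.range b, e (d * (x - y) / b) = if x = y then (b : ℂ) else 0 := by
  have hdvd : (b : ℤ) ∣ (x - y : ℤ) ↔ x = y := by
    rw [← Int.modEq_iff_dvd, Int.natCast_modEq_iff, Nat.ModEq, Nat.mod_eq_of_lt hx,
      Nat.mod_eq_of_lt hy, eq_comm]
  simpa [hdvd] using sum_range_e_mul_div b (x - y)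

theorem sum_norm_sq_of_orthogonal {ι κ : Type*} [DecidableEq κ] {s : Finset ι} {t : Finset κ}
    {φ : κ → ι → ℂ} {N : ℝ}
    (hφ : ∀ k ∈ t, ∀ l ∈ t, ∑ q ∈ s, φ k q * conj (φ l q) = if k = l then (N : ℂ) else 0)
    (v : κ → ℂ) :
    ∑ q ∈ s, ‖∑ k ∈ t, v k * φ k q‖ ^ 2 = N * ∑ k ∈ t, ‖v k‖ ^ 2 := by
  apply Complex.ofReal_injective
  push_cast
  simp only [← Complex.mul_conj', map_sum, map_mul, Finset.sum_mul_sum]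
  rw [Finset.sum_comm, Finset.mul_sum]
  refine Finset.sum_congr rfl fun k hk => ?_
  calc ∑ q ∈ s, ∑ l ∈ t, v k * φ k q * (conj (v l) * conj (φ l q))
      = ∑ l ∈ t, v k * conj (v l) * ∑ q ∈ s, φ k q * conj (φ l q) := by
        rw [Finset.sum_comm]
        simp only [mul_mul_mul_comm, Finset.mul_sum]
    _ = ∑ l ∈ t, if k = l then N * (v k * conj (v l)) else 0 := by
        refine Finset.sum_congr rfl fun l hl => ?_
        rw [hφ k hk l hl, mul_ite, mul_zero, mul_comm]
    _ = N * (v k * conj (v k)) := by rw [Finset.sum_ite_eq, if_pos hk]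

/-- The normalized Dirichlet kernel `b⁻¹ ∑_{d < b} e(d t / b)`. It interpolates the indicator
function of the multiples of `b` among the integers, so that `κ ↦ dirichletMean b (t - κ)` are the
coefficients of `x ↦ e(t x / b)` with respect to the characters of the digits modulo `b`. -/
def dirichletMean (b : ℕ) (t : ℝ) : ℂ := (b : ℂ)⁻¹ * ∑ d ∈ Finset.range b, e (d * t / b)

section DirichletMean

variable (b : ℕ) [NeZero b]

theorem norm_dirichletMean_le_one (t : ℝ) : ‖dirichletMean b t‖ ≤ 1 := by
  rw [dirichletMean, norm_mul, norm_inv, Complex.norm_natCast,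
    inv_mul_le_one₀ (Nat.cast_pos.mpr (NeZero.pos b))]
  refine (norm_sum_le _ _).trans_eq ?_
  simp [norm_e]

theorem dirichletMean_intCast (m : ℤ) : dirichletMean b m = if (b : ℤ) ∣ m then 1 else 0 := by
  rw [dirichletMean, sum_range_e_mul_div, mul_ite, mul_zero, inv_mul_cancel₀ (NeZero.ne _)]

theorem dirichletMean_add_mul (t : ℝ) (m : ℤ) :
    dirichletMean b (t + b * m) = dirichletMean b t := by
  refine congrArg ((b : ℂ)⁻¹ * ·) (Finset.sum_congr rfl fun d _ => ?_)
  rw [← e_add_intCast (d * t / b) (d * m)]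
  push_cast
  field_simp [NeZero.ne (b : ℝ)]

theorem norm_dirichletMean_sub_le (s t : ℝ) :
    ‖dirichletMean b s - dirichletMean b t‖ ≤ 2 * Real.pi * |s - t| := by
  have hb : (0 : ℝ) < b := Nat.cast_pos.mpr (NeZero.pos b)
  have hterm : ∀ d ∈ Finset.range b,
      ‖e (d * s / b) - e (d * t / b)‖ ≤ 2 * Real.pi * |s - t| := fun d hd => by
    refine (norm_e_sub_e_le _ _).trans ?_
    have hd : (d : ℝ) / b ≤ 1 := by
      rw [div_le_one hb]
      exact_mod_cast (Finset.mem_range.mp hd).le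
    calc 2 * Real.pi * |d * s / b - d * t / b| = 2 * Real.pi * (d / b * |s - t|) := by
          rw [← abs_of_nonneg (show (0 : ℝ) ≤ d / b by positivity), ← abs_mul]
          ring_nf
      _ ≤ 2 * Real.pi * (1 * |s - t|) := by gcongr
      _ = 2 * Real.pi * |s - t| := by rw [one_mul]
  rw [dirichletMean, dirichletMean, ← mul_sub, ← Finset.sum_sub_distrib, norm_mul, norm_inv,
    Complex.norm_natCast, inv_mul_le_iff₀ hb]
  exact (norm_sum_le_of_le _ hterm).trans_eq (by simp)

theorem norm_dirichletMean_sub_natCast_le (t : ℝ) {κ : ℕ} (h0 : κ ≠ 0) (hκ : κ < b) :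
    ‖dirichletMean b (t - κ)‖ ≤ 2 * Real.pi * |t| := by
  have hzero : dirichletMean b (-κ) = 0 := by
    have hdvd : ¬ (b : ℤ) ∣ -κ := by
      rw [dvd_neg, Int.natCast_dvd_natCast]
      exact Nat.not_dvd_of_pos_of_lt (Nat.pos_of_ne_zero h0) hκ
    simpa [hdvd] using dirichletMean_intCast b (-κ)
  simpa [hzero] using norm_dirichletMean_sub_le b (t - κ) (-κ)

theorem sum_dirichletMean_sub_mul_e (t : ℝ) {x : ℕ} (hx : x < b) :
    ∑ κ ∈ Finset.range b, dirichletMean b (t - κ) * e (κ * x / b) = e (t * x / b) := by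
  calc ∑ κ ∈ Finset.range b, dirichletMean b (t - κ) * e (κ * x / b)
      = (b : ℂ)⁻¹ * ∑ d ∈ Finset.range b,
          e (t * d / b) * ∑ κ ∈ Finset.range b, e (κ * (x - d) / b) := by
        simp only [dirichletMean, mul_assoc, Finset.sum_mul, Finset.mul_sum]
        rw [Finset.sum_comm]
        refine Finset.sum_congr rfl fun d _ => Finset.sum_congr rfl fun κ _ => ?_
        rw [← AddChar.map_add_eq_mul, ← AddChar.map_add_eq_mul]
        ring_nf
    _ = (b : ℂ)⁻¹ * ∑ d ∈ Finset.range b, if x = d then e (t * d / b) * b else 0 := by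
        refine congrArg _ (Finset.sum_congr rfl fun d hd => ?_)
        rw [sum_range_e_mul_sub_div b hx (Finset.mem_range.mp hd), mul_ite, mul_zero]
    _ = e (t * x / b) := by
        rw [Finset.sum_ite_eq, if_pos (Finset.mem_range.mpr hx), mul_comm,
          mul_inv_cancel_right₀ (NeZero.ne _)]

theorem sum_norm_sq_dirichletMean_add (t : ℝ) :
    ∑ τ ∈ Finset.range b, ‖dirichletMean b (t + τ)‖ ^ 2 = 1 := by
  have horth : ∀ d ∈ Finset.range b, ∀ d' ∈ Finset.range b,
      ∑ τ ∈ Finset.range b, e (τ * d / b) * conj (e (τ * d' / b)) =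
        if d = d' then ((b : ℝ) : ℂ) else 0 := fun d hd d' hd' => by
    rw [Complex.ofReal_natCast,
      ← sum_range_e_mul_sub_div b (Finset.mem_range.mp hd) (Finset.mem_range.mp hd')]
    refine Finset.sum_congr rfl fun τ _ => ?_
    rw [conj_e, ← AddChar.map_add_eq_mul]
    ring_nf
  have hsum := sum_norm_sq_of_orthogonal horth fun d => (b : ℂ)⁻¹ * e (d * t / b)
  calc ∑ τ ∈ Finset.range b, ‖dirichletMean b (t + τ)‖ ^ 2
      = ∑ τ ∈ Finset.range b,
          ‖∑ d ∈ Finset.range b, (b : ℂ)⁻¹ * e (d * t / b) * e (τ * d / b)‖ ^ 2 := by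
        refine Finset.sum_congr rfl fun τ _ => ?_
        rw [dirichletMean, Finset.mul_sum]
        congr 3 with d
        rw [mul_assoc, ← AddChar.map_add_eq_mul]
        ring_nf
    _ = b * ∑ d ∈ Finset.range b, ((b : ℝ)⁻¹) ^ 2 := by
        rw [hsum]
        simp [norm_e]
    _ = 1 := by
        rw [Finset.sum_const, Finset.card_range, nsmul_eq_mul]
        field_simp [NeZero.ne (b : ℝ)]

end DirichletMean

/-! ### Digits of natural numbers -/

section NatDigit

variable {b : ℕ}

theorem natDigit_lt (hb : 0 < b) (k j : ℕ) : natDigit b k j < b := Nat.mod_lt _ hb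

theorem natDigit_zero_left (b j : ℕ) : natDigit b 0 j = 0 := by
  rw [natDigit, Nat.zero_div, Nat.zero_mod]

theorem natDigit_eq_zero (hb : 0 < b) {k n j : ℕ} (hk : k < b ^ n) (hj : n ≤ j) :
    natDigit b k j = 0 := by
  rw [natDigit, Nat.div_eq_of_lt (hk.trans_le (Nat.pow_le_pow_right hb hj)), Nat.zero_mod]

theorem natDigit_add_mul_of_lt (hb : 0 < b) {n j : ℕ} (r d : ℕ) (hj : j < n) :
    natDigit b (r + b ^ n * d) j = natDigit b r j := by
  obtain ⟨i, rfl⟩ := Nat.exists_eq_add_of_lt hj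
  have hsplit : b ^ (j + i + 1) * d = b ^ j * (b * (b ^ i * d)) := by ring
  rw [natDigit, natDigit, hsplit, Nat.add_mul_div_left _ _ (by positivity),
    Nat.add_mul_mod_self_left]

theorem natDigit_add_mul_self {n r d : ℕ} (hr : r < b ^ n) (hd : d < b) :
    natDigit b (r + b ^ n * d) n = d := by
  rw [natDigit, Nat.add_mul_div_left _ _ (by omega), Nat.div_eq_of_lt hr, zero_add,
    Nat.mod_eq_of_lt hd]

theorem eq_of_natDigit_eq {n k l : ℕ} (hk : k < b ^ n) (hl : l < b ^ n)
    (h : ∀ j < n, natDigit b k j = natDigit b l j) : k = l := by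
  have hmod : ∀ m ≤ n, k % b ^ m = l % b ^ m := fun m hm => by
    induction m with
    | zero => simp [Nat.mod_one]
    | succ m ih =>
      rw [Nat.mod_pow_succ, Nat.mod_pow_succ, ih (by omega)]
      exact congrArg _ (congrArg _ (h m hm))
  simpa only [Nat.mod_eq_of_lt hk, Nat.mod_eq_of_lt hl] using hmod n le_rfl

theorem natDigit_injective (hb : 2 ≤ b) : Function.Injective (natDigit b) := fun k l h => by
  have hlt (m : ℕ) (hm : m ≤ max k l) : m < b ^ max k l :=
    hm.trans_lt (Nat.lt_pow_self (by omega))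
  exact eq_of_natDigit_eq (hlt k (le_max_left k l)) (hlt l (le_max_right k l)) fun j _ =>
    congrFun h j

theorem sum_range_mul {M : Type*} [AddCommMonoid M] (m b : ℕ) (g : ℕ → M) :
    ∑ k ∈ Finset.range (m * b), g k =
      ∑ d ∈ Finset.range b, ∑ r ∈ Finset.range m, g (r + m * d) := by
  induction b with
  | zero => simp
  | succ b ih =>
    rw [Nat.mul_succ, Finset.sum_range_add, Finset.sum_range_succ, ih]
    simp only [add_comm]

theorem sum_prod_natDigit {M : Type*} [CommSemiring M] (b n : ℕ) (f : ℕ → ℕ → M) :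
    ∑ k ∈ Finset.range (b ^ n), ∏ j ∈ Finset.range n, f j (natDigit b k j) =
      ∏ j ∈ Finset.range n, ∑ d ∈ Finset.range b, f j d := by
  induction n with
  | zero => simp
  | succ n ih =>
    rw [pow_succ, sum_range_mul, Finset.prod_range_succ, ← ih, Finset.sum_mul_sum,
      Finset.sum_comm]
    refine Finset.sum_congr rfl fun r hr => Finset.sum_congr rfl fun d hd => ?_
    have hr := Finset.mem_range.mp hr
    have hd := Finset.mem_range.mp hd
    rw [Finset.prod_range_succ, natDigit_add_mul_self hr hd]
    refine congrArg (· * _) (Finset.prod_congr rfl fun j hj => ?_)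
    rw [natDigit_add_mul_of_lt (by omega) _ _ (Finset.mem_range.mp hj)]

/-- Digit-wise negation modulo `b`. It corresponds to complex conjugation of Walsh functions. -/
def digitNeg (b k : ℕ) : ℕ := Nat.ofDigits b ((Nat.digits b k).map fun d => (b - d) % b)

theorem natDigit_digitNeg (hb : 2 ≤ b) (k j : ℕ) :
    natDigit b (digitNeg b k) j = (b - natDigit b k j) % b := by
  have hlt : ∀ d ∈ (Nat.digits b k).map fun d => (b - d) % b, d < b := by
    simp only [List.mem_map]
    rintro _ ⟨d, -, rfl⟩
    exact Nat.mod_lt _ (by omega)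
  rw [natDigit, digitNeg, Nat.ofDigits_div_pow_eq_ofDigits_drop j (by omega) _ hlt,
    Nat.ofDigits_mod_eq_head!, natDigit, ← Nat.getD_digits k j hb, List.getD_eq_getElem?_getD,
    List.head!_eq_head?_getD, List.head?_drop, List.getElem?_map]
  cases (Nat.digits b k)[j]? <;> simp

theorem natDigit_digitNeg_eq_zero_iff (hb : 2 ≤ b) {k j : ℕ} :
    natDigit b (digitNeg b k) j = 0 ↔ natDigit b k j = 0 := by
  have hlt := natDigit_lt (b := b) (by omega) k j
  rw [natDigit_digitNeg hb]
  refine ⟨fun h => ?_, fun h => by simp [h]⟩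
  by_contra hne
  rw [Nat.mod_eq_of_lt (by omega)] at h
  omega

theorem digitNeg_involutive (hb : 2 ≤ b) : Function.Involutive (digitNeg b) := fun k =>
  natDigit_injective hb <| funext fun j => by
    have hlt := natDigit_lt (b := b) (by omega) k j
    rw [natDigit_digitNeg hb, natDigit_digitNeg hb]
    obtain h0 | hpos := Nat.eq_zero_or_pos (natDigit b k j)
    · simp [h0]
    · rw [Nat.mod_eq_of_lt (Nat.sub_lt (by omega) hpos), Nat.sub_sub_self hlt.le,
        Nat.mod_eq_of_lt hlt]

theorem digitNeg_ne_zero (hb : 2 ≤ b) {k : ℕ} (hk : k ≠ 0) : digitNeg b k ≠ 0 := by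
  have hzero : digitNeg b 0 = 0 := by simp [digitNeg]
  rw [← hzero]
  exact (digitNeg_involutive hb).injective.ne hk

end NatDigit

/-! ### Walsh functions -/

section Walsh

variable {b : ℕ}

theorem wal_eq_prod (hb : 2 ≤ b) {k n : ℕ} (hk : k < b ^ n) (d : ℕ → Fin b) :
    wal b k d = ∏ j ∈ Finset.range n, e (natDigit b k j * (d j : ℕ) / b) := by
  have hzero : ∀ N, k < b ^ N → ∀ j ∉ Finset.range N, natDigit b k j * (d j : ℕ) = 0 :=
    fun N hN j hj => by
      rw [natDigit_eq_zero (by omega) hN (by simpa using hj), zero_mul]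
  have hsum : ∑ l ∈ Finset.range k, natDigit b k l * (d l : ℕ) =
      ∑ l ∈ Finset.range n, natDigit b k l * (d l : ℕ) :=
    Finset.sum_congr_of_eq_on_inter (fun j _ hj => hzero n hk j hj)
      (fun j _ hj => hzero k (Nat.lt_pow_self (by omega)) j hj) fun _ _ _ => rfl
  rw [wal, hsum, ← e_sum, e_apply, ← Finset.sum_div]
  push_cast
  ring_nf

theorem norm_wal (hb : 2 ≤ b) (k : ℕ) (d : ℕ → Fin b) : ‖wal b k d‖ = 1 := by
  rw [wal_eq_prod hb (Nat.lt_pow_self (n := k) (by omega)), norm_prod]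
  exact Finset.prod_eq_one fun j _ => norm_e _

theorem wal_digitNeg (hb : 2 ≤ b) (k : ℕ) (d : ℕ → Fin b) :
    wal b (digitNeg b k) d = conj (wal b k d) := by
  have : NeZero b := ⟨by omega⟩
  have hlt (l : ℕ) (hl : l ≤ max (digitNeg b k) k) : l < b ^ max (digitNeg b k) k :=
    hl.trans_lt (Nat.lt_pow_self (by omega))
  rw [wal_eq_prod hb (hlt _ (le_max_left _ _)), wal_eq_prod hb (hlt _ (le_max_right _ _)), map_prod]
  refine Finset.prod_congr rfl fun j _ => ?_
  have hmod : ((natDigit b (digitNeg b k) j * (d j : ℕ) : ℕ) : ℤ) ≡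
      -(natDigit b k j * (d j : ℕ) : ℕ) [ZMOD b] := by
    have hlt := natDigit_lt (b := b) (by omega) k j
    rw [natDigit_digitNeg hb, Nat.cast_mul, Nat.cast_mul, ← neg_mul, Int.natCast_mod,
      Nat.cast_sub hlt.le]
    refine Int.ModEq.mul_right _ ((Int.mod_modEq _ _).trans ?_)
    exact Int.modEq_iff_dvd.mpr ⟨-1, by ring⟩
  have he := e_div_eq_of_modEq hmod
  push_cast at he
  rw [conj_e, ← neg_div, he]

variable [NeZero b]

theorem wal_add (hb : 2 ≤ b) (k : ℕ) (d d' : ℕ → Fin b) :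
    wal b k (d + d') = wal b k d * wal b k d' := by
  have hk : k < b ^ k := Nat.lt_pow_self (by omega)
  rw [wal_eq_prod hb hk, wal_eq_prod hb hk, wal_eq_prod hb hk, ← Finset.prod_mul_distrib]
  refine Finset.prod_congr rfl fun j _ => ?_
  have hmod : natDigit b k j * ((d j + d' j : Fin b) : ℕ) ≡
      natDigit b k j * (d j + d' j) [MOD b] := by
    rw [Fin.val_add]
    exact (Nat.mod_modEq _ _).mul_left _
  have he := e_div_eq_of_modEq (Int.natCast_modEq_iff.mpr hmod)
  push_cast at he
  rw [Pi.add_apply, ← AddChar.map_add_eq_mul, ← add_div, ← mul_add, he]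

theorem wal_sub (hb : 2 ≤ b) (k : ℕ) (d d' : ℕ → Fin b) :
    wal b k (d - d') = wal b k d * conj (wal b k d') := by
  have hd : wal b k d = wal b k (d - d') * wal b k d' := by rw [← wal_add hb, sub_add_cancel]
  rw [hd, mul_assoc, Complex.mul_conj', norm_wal hb, Complex.ofReal_one, one_pow, mul_one]

/-! ### Walsh kernels -/

/-- The Walsh transform `k ↦ ∑ₓ aₓ wal_k(x)` of a finitely supported signed measure on `[0,1)`. -/
def walshTransform (b : ℕ) [NeZero b] (a : I →₀ ℝ) (k : ℕ) : ℂ :=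
  pairing a fun x => wal b k (Real.digits x b)

variable {r : ℕ → ℝ}

theorem summable_walshTerm (hb : 2 ≤ b) (hr : Summable r) (x x' : ℝ) :
    Summable (walshTerm b r x x') := by
  refine Summable.of_norm ?_
  simp only [walshTerm, norm_mul, norm_wal hb, mul_one, Complex.norm_real]
  exact hr.norm.comp_injective PNat.coe_injective

theorem hasSum_walshTerm (hb : 2 ≤ b) (hr : Summable r) (hneg : ∀ k, r (digitNeg b k) = r k)
    (x x' : ℝ) : HasSum (walshTerm b r x x') (walshKernel b r x x' : ℂ) := by
  let ν : ℕ+ ≃ ℕ+ := Function.Involutive.toPerm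
    (fun k => ⟨digitNeg b k, Nat.pos_of_ne_zero (digitNeg_ne_zero hb k.ne_zero)⟩)
    fun k => PNat.coe_injective (digitNeg_involutive hb k)
  have hconj (k : ℕ+) : walshTerm b r x x' (ν k) = conj (walshTerm b r x x' k) := by
    change (r (digitNeg b k) : ℂ) * wal b (digitNeg b k) _ = _
    rw [hneg, wal_digitNeg hb, walshTerm, map_mul, Complex.conj_ofReal]
  have hreal : ((walshKernel b r x x' : ℝ) : ℂ) = ∑' k, walshTerm b r x x' k := by
    rw [walshKernel, ← Complex.conj_eq_iff_re, Complex.conj_tsum]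
    exact (tsum_congr fun k => (hconj k).symm).trans (ν.tsum_eq _)
  rw [hreal]
  exact (summable_walshTerm hb hr x x').hasSum

theorem hasSum_walshKernel (hb : 2 ≤ b) (hr : Summable r) (x y : I) :
    HasSum (fun k : ℕ+ => r k * (wal b k (Real.digits x b) * conj (wal b k (Real.digits y b))).re)
      (onI (walshKernel b r) x y) := by
  refine (Complex.hasSum_re (summable_walshTerm hb hr x y).hasSum).congr_fun fun k => ?_
  rw [walshTerm, digitSub, wal_sub hb, Complex.re_ofReal_mul]

theorem isSPSD_walshKernel (hb : 2 ≤ b) (hr : Summable r) (hr0 : ∀ k, 0 ≤ r k) :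
    IsSPSD (walshKernel b r) :=
  posSemidef_of_hasSum (fun k : ℕ+ => hr0 k) (hasSum_walshKernel hb hr)

theorem hasSum_quadForm_walshKernel (hb : 2 ≤ b) (hr : Summable r) (a : I →₀ ℝ) :
    HasSum (fun k : ℕ+ => r k * ‖walshTransform b a k‖ ^ 2)
      (quadForm (onI (walshKernel b r)) a) :=
  hasSum_quadForm (hasSum_walshKernel hb hr) a

theorem quadForm_walshKernel_mono (hb : 2 ≤ b) {r' : ℕ → ℝ} (hr : Summable r) (hr' : Summable r')
    (hle : ∀ k, r k ≤ r' k) (a : I →₀ ℝ) :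
    quadForm (onI (walshKernel b r)) a ≤ quadForm (onI (walshKernel b r')) a :=
  hasSum_le (fun k : ℕ+ => mul_le_mul_of_nonneg_right (hle k) (sq_nonneg _))
    (hasSum_quadForm_walshKernel hb hr a) (hasSum_quadForm_walshKernel hb hr' a)

theorem sum_Ico_le_quadForm_walshKernel (hb : 2 ≤ b) (hr : Summable r) (hr0 : ∀ k, 0 ≤ r k)
    (a : I →₀ ℝ) (N : ℕ) :
    ∑ k ∈ Finset.Ico 1 N, r k * ‖walshTransform b a k‖ ^ 2 ≤
      quadForm (onI (walshKernel b r)) a := by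
  let s : Finset ℕ+ := (Finset.Ico 1 N).subtype (0 < ·)
  have hs : ∑ k ∈ Finset.Ico 1 N, r k * ‖walshTransform b a k‖ ^ 2 =
      ∑ k ∈ s, r k * ‖walshTransform b a k‖ ^ 2 :=
    (Finset.sum_subtype_of_mem _ fun k hk => (Finset.mem_Ico.mp hk).1).symm
  rw [hs]
  exact sum_le_hasSum s (fun k _ => mul_nonneg (hr0 k) (sq_nonneg _))
    (hasSum_quadForm_walshKernel hb hr a)

end Walsh

/-! ### Truncated digit expansions -/

section Trunc

variable {b : ℕ}

/-- The value `∑_{j < n} d_j b ^ (-(j + 1))` of the first `n` digits. -/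
def trunc (n : ℕ) (d : ℕ → Fin b) : ℝ := ∑ j ∈ Finset.range n, Real.ofDigitsTerm d j

theorem trunc_congr {n : ℕ} {d d' : ℕ → Fin b} (h : ∀ j < n, d j = d' j) :
    trunc n d = trunc n d' :=
  Finset.sum_congr rfl fun j hj => by
    rw [Real.ofDigitsTerm, Real.ofDigitsTerm, h j (Finset.mem_range.mp hj)]

theorem tendsto_trunc (d : ℕ → Fin b) :
    Tendsto (fun n => trunc n d) atTop (𝓝 (Real.ofDigits d)) :=
  Real.summable_ofDigitsTerm.hasSum.tendsto_sum_nat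

theorem e_mul_trunc (t : ℝ) (n : ℕ) (d : ℕ → Fin b) :
    e (t * trunc n d) = ∏ j ∈ Finset.range n, e (t / b ^ j * (d j : ℕ) / b) := by
  rw [trunc, Finset.mul_sum, e_sum]
  refine Finset.prod_congr rfl fun j _ => congrArg e ?_
  rw [Real.ofDigitsTerm, pow_succ, mul_inv]
  ring

variable [NeZero b]

/-- The first `n` entries are the digits of `q / b ^ n`; the remaining ones are irrelevant. -/
def gridDigits (b n : ℕ) [NeZero b] (q : ℕ) : ℕ → Fin b :=
  fun j => Fin.ofNat b (q / b ^ (n - 1 - j))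

theorem gridDigits_val {n j : ℕ} (q : ℕ) : (gridDigits b n q j : ℕ) = natDigit b q (n - 1 - j) :=
  Fin.val_ofNat ..

theorem digits_eq_gridDigits (n : ℕ) (σ : ℝ) {j : ℕ} (hj : j < n) :
    Real.digits σ b j = gridDigits b n ⌊σ * (b : ℝ) ^ n⌋₊ j := by
  have hpow : (b : ℝ) ^ n = (b : ℝ) ^ (j + 1) * (b : ℝ) ^ (n - 1 - j) := by
    rw [← pow_add]
    congr 1
    omega
  have hscale : σ * (b : ℝ) ^ (j + 1) = σ * (b : ℝ) ^ n / ((b ^ (n - 1 - j) : ℕ) : ℝ) := by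
    rw [hpow, Nat.cast_pow, ← mul_assoc, mul_div_cancel_right₀ _ (pow_ne_zero _ (NeZero.ne _))]
  rw [Real.digits, gridDigits, hscale, Nat.floor_div_natCast]

theorem sum_wal_gridDigits (hb : 2 ≤ b) {n k l : ℕ} (hk : k < b ^ n) (hl : l < b ^ n) :
    ∑ q ∈ Finset.range (b ^ n), wal b k (gridDigits b n q) * conj (wal b l (gridDigits b n q)) =
      if k = l then (((b : ℝ) ^ n : ℝ) : ℂ) else 0 := by
  let κ : ℕ → ℕ := fun j => natDigit b k (n - 1 - j)
  let κ' : ℕ → ℕ := fun j => natDigit b l (n - 1 - j)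
  have hprod : ∀ q, wal b k (gridDigits b n q) * conj (wal b l (gridDigits b n q)) =
      ∏ j ∈ Finset.range n, e (natDigit b q j * (κ j - κ' j) / b) := fun q => by
    rw [wal_eq_prod hb hk, wal_eq_prod hb hl, map_prod, ← Finset.prod_mul_distrib,
      ← Finset.prod_range_reflect]
    refine Finset.prod_congr rfl fun j hj => ?_
    have hj : n - 1 - (n - 1 - j) = j := by
      have := Finset.mem_range.mp hj
      omega
    rw [gridDigits_val, hj, conj_e, ← AddChar.map_add_eq_mul]
    refine congrArg e ?_
    ring
  have hdigit (i j : ℕ) : natDigit b i j < b := natDigit_lt (by omega) i j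
  rw [Finset.sum_congr rfl fun q _ => hprod q, sum_prod_natDigit b n fun j d =>
    e (d * (κ j - κ' j) / b), Finset.prod_congr rfl fun j _ =>
    sum_range_e_mul_sub_div b (hdigit k _) (hdigit l _)]
  split_ifs with hkl
  · simp [hkl]
  · obtain ⟨j, hj, hne⟩ : ∃ j < n, natDigit b k j ≠ natDigit b l j := by
      by_contra! hcon
      exact hkl (eq_of_natDigit_eq hk hl hcon)
    refine Finset.prod_eq_zero (i := n - 1 - j) (Finset.mem_range.mpr (by omega)) (if_neg ?_)
    rwa [show n - 1 - (n - 1 - j) = j by omega]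

theorem sum_norm_sq_walsh_gridDigits (hb : 2 ≤ b) (n : ℕ) (v : ℕ → ℂ) :
    ∑ q ∈ Finset.range (b ^ n), ‖∑ k ∈ Finset.range (b ^ n), v k * wal b k (gridDigits b n q)‖ ^ 2 =
      (b : ℝ) ^ n * ∑ k ∈ Finset.range (b ^ n), ‖v k‖ ^ 2 :=
  sum_norm_sq_of_orthogonal (fun _ hk _ hl =>
    sum_wal_gridDigits hb (Finset.mem_range.mp hk) (Finset.mem_range.mp hl)) v

end Trunc

/-! ### Walsh coefficients of truncated characters -/

section WalshCoeff

variable {b : ℕ}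

/-- The `k`-th Walsh coefficient of `d ↦ e(t · trunc n d)`, for `k < b ^ n`. It factors over the
digits of `k` because the truncated character factors over the digits of the argument. -/
def walshCoeff (b n : ℕ) (t : ℝ) (k : ℕ) : ℂ :=
  ∏ j ∈ Finset.range n, dirichletMean b (t / b ^ j - natDigit b k j)

theorem walshCoeff_succ (b n : ℕ) (t : ℝ) (k : ℕ) :
    walshCoeff b (n + 1) t k =
      walshCoeff b n t k * dirichletMean b (t / b ^ n - natDigit b k n) :=
  Finset.prod_range_succ ..

variable [NeZero b]

theorem sum_walshCoeff_mul_wal (hb : 2 ≤ b) (n : ℕ) (t : ℝ) (d : ℕ → Fin b) :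
    ∑ k ∈ Finset.range (b ^ n), walshCoeff b n t k * wal b k d = e (t * trunc n d) := by
  have hprod : ∀ k ∈ Finset.range (b ^ n), walshCoeff b n t k * wal b k d =
      ∏ j ∈ Finset.range n, dirichletMean b (t / b ^ j - natDigit b k j) *
        e (natDigit b k j * (d j : ℕ) / b) := fun k hk => by
    rw [walshCoeff, wal_eq_prod hb (Finset.mem_range.mp hk), Finset.prod_mul_distrib]
  rw [Finset.sum_congr rfl hprod, sum_prod_natDigit b n fun j κ =>
    dirichletMean b (t / b ^ j - κ) * e (κ * (d j : ℕ) / b), e_mul_trunc]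
  exact Finset.prod_congr rfl fun j _ => sum_dirichletMean_sub_mul_e b _ (d j).2

theorem norm_walshCoeff_le_one (n : ℕ) (t : ℝ) (k : ℕ) : ‖walshCoeff b n t k‖ ≤ 1 := by
  rw [walshCoeff, norm_prod]
  exact Finset.prod_le_one (fun _ _ => norm_nonneg _) fun _ _ => norm_dirichletMean_le_one b _

theorem walshCoeff_add_mul (m : ℕ) (t : ℝ) (q : ℤ) (k : ℕ) :
    walshCoeff b m (t + b ^ m * q) k = walshCoeff b m t k := by
  refine Finset.prod_congr rfl fun j hj => ?_
  obtain ⟨i, rfl⟩ := Nat.exists_eq_add_of_lt (Finset.mem_range.mp hj)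
  rw [← dirichletMean_add_mul b (t / b ^ j - natDigit b k j) (b ^ i * q)]
  congr 1
  push_cast
  field_simp [NeZero.ne (b : ℝ)]
  ring

theorem sum_norm_sq_walshCoeff (m k : ℕ) :
    ∑ r ∈ Finset.range (b ^ m), ‖walshCoeff b m r k‖ ^ 2 = 1 := by
  induction m with
  | zero => simp [walshCoeff]
  | succ m ih =>
    rw [pow_succ, sum_range_mul, Finset.sum_comm, ← ih]
    refine Finset.sum_congr rfl fun r _ => ?_
    have hfactor (τ : ℕ) : ‖walshCoeff b (m + 1) ((r + b ^ m * τ : ℕ) : ℝ) k‖ ^ 2 =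
        ‖walshCoeff b m r k‖ ^ 2 *
          ‖dirichletMean b ((r : ℝ) / b ^ m - natDigit b k m + τ)‖ ^ 2 := by
      have hperiod := walshCoeff_add_mul (b := b) m r τ k
      rw [Int.cast_natCast] at hperiod
      push_cast
      rw [walshCoeff_succ, hperiod, norm_mul, mul_pow, add_div,
        mul_div_cancel_left₀ _ (pow_ne_zero _ (NeZero.ne _)), add_sub_right_comm]
    simp only [hfactor]
    rw [← Finset.mul_sum, sum_norm_sq_dirichletMean_add, mul_one]

theorem pow_dvd_of_walshCoeff_ne_zero {m k : ℕ} {h : ℤ} (hk : ∀ j < m, natDigit b k j = 0)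
    (hc : walshCoeff b m h k ≠ 0) : (b : ℤ) ^ m ∣ h := by
  induction m with
  | zero => simp
  | succ m ih =>
    rw [walshCoeff_succ, hk m m.lt_succ_self] at hc
    obtain ⟨q, rfl⟩ := ih (fun j hj => hk j (by omega)) (left_ne_zero_of_mul hc)
    have hquot : (((b ^ m * q : ℤ) : ℝ) / b ^ m - (0 : ℕ)) = q := by
      push_cast
      rw [sub_zero, mul_div_cancel_left₀ _ (pow_ne_zero _ (NeZero.ne _))]
    have hdvd : (b : ℤ) ∣ q := by
      by_contra hndvd
      refine right_ne_zero_of_mul hc ?_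
      rw [hquot, dirichletMean_intCast, if_neg hndvd]
    rw [pow_succ]
    exact mul_dvd_mul_left _ hdvd

theorem pairing_e_mul_trunc {X : Type*} (hb : 2 ≤ b) (n : ℕ) (t : ℝ) (δ : X → ℕ → Fin b)
    (a : X →₀ ℝ) :
    pairing a (fun x => e (t * trunc n (δ x))) =
      ∑ k ∈ Finset.range (b ^ n), walshCoeff b n t k * pairing a fun x => wal b k (δ x) := by
  simp only [← sum_walshCoeff_mul_wal hb, pairing_sum]

end WalshCoeff

/-! ### Dick weights -/

section Weights

variable {b : ℕ}

/-- The decreasing list of the positions of the nonzero base-`b` digits of `k`, counted from `0`. -/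
def digitSupport (b k : ℕ) : List ℕ := (List.range k).reverse.filter fun a => natDigit b k a ≠ 0

theorem positions_eq_map_digitSupport (b k : ℕ) : positions b k = (digitSupport b k).map (· + 1) :=
  rfl

theorem mem_digitSupport (hb : 2 ≤ b) {k j : ℕ} : j ∈ digitSupport b k ↔ natDigit b k j ≠ 0 := by
  have hlt (hj : natDigit b k j ≠ 0) : j < k := by
    by_contra! hkj
    exact hj (natDigit_eq_zero (by omega) (Nat.lt_pow_self (by omega)) hkj)
  simpa [digitSupport] using hlt

theorem sortedGT_digitSupport (b k : ℕ) : (digitSupport b k).SortedGT :=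
  ((List.pairwise_reverse.mpr List.pairwise_lt_range).filter _).sortedGT

theorem digitSupport_ne_nil (hb : 2 ≤ b) {k : ℕ} (hk : k ≠ 0) : digitSupport b k ≠ [] := fun hnil =>
  hk <| natDigit_injective hb <| funext fun j => by
    rw [natDigit_zero_left, ← not_ne_iff, ← mem_digitSupport hb, hnil]
    exact List.not_mem_nil

theorem muRing_zero (b α : ℕ) : muRing b α 0 = 0 := by simp [muRing, mu, positions]

theorem muRing_digitNeg (hb : 2 ≤ b) (α k : ℕ) : muRing b α (digitNeg b k) = muRing b α k := by
  have hsupp : digitSupport b (digitNeg b k) = digitSupport b k :=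
    (sortedGT_digitSupport b _).eq_of_mem_iff (sortedGT_digitSupport b k) fun j => by
      rw [mem_digitSupport hb, mem_digitSupport hb, Ne, natDigit_digitNeg_eq_zero_iff hb]
  rw [muRing, muRing, mu, mu, positions_eq_map_digitSupport, positions_eq_map_digitSupport, hsupp]

theorem rRing2_digitNeg (hb : 2 ≤ b) (α k : ℕ) : rRing2 b α (digitNeg b k) = rRing2 b α k := by
  rw [rRing2, rRing2, muRing_digitNeg hb]

theorem rRingRing2_digitNeg (hb : 2 ≤ b) (α k : ℕ) :
    rRingRing2 b α (digitNeg b k) = rRingRing2 b α k := by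
  rw [rRingRing2, rRingRing2, muRing_digitNeg hb]

theorem digitSupport_add_mul (hb : 2 ≤ b) {n r d : ℕ} (hr : r < b ^ n) (hd0 : 0 < d) (hd : d < b) :
    digitSupport b (r + b ^ n * d) = n :: digitSupport b r := by
  have hlt : ∀ j ∈ digitSupport b r, j < n := fun j hj => by
    by_contra! hnj
    exact (mem_digitSupport hb).mp hj (natDigit_eq_zero (by omega) hr hnj)
  refine (sortedGT_digitSupport b _).eq_of_mem_iff
    (List.pairwise_cons.mpr ⟨hlt, (sortedGT_digitSupport b r).pairwise⟩).sortedGT fun j => ?_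
  rw [List.mem_cons, mem_digitSupport hb, mem_digitSupport hb]
  rcases lt_trichotomy j n with hjn | rfl | hnj
  · rw [natDigit_add_mul_of_lt (by omega) _ _ hjn, or_iff_right hjn.ne]
  · rw [natDigit_add_mul_self hr hd]
    simp [hd0.ne']
  · have hk : r + b ^ n * d < b ^ (n + 1) := by
      calc r + b ^ n * d < b ^ n + b ^ n * d := by omega
        _ = b ^ n * (d + 1) := by ring
        _ ≤ b ^ n * b := Nat.mul_le_mul_left _ hd
        _ = b ^ (n + 1) := (pow_succ b n).symm
    rw [natDigit_eq_zero (by omega) hk hnj, natDigit_eq_zero (by omega) hr hnj.le]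
    simp [hnj.ne']

theorem add_headD_positions_le_muRing (hb : 2 ≤ b) {α n r d : ℕ} (hα : 2 ≤ α) (hr : r < b ^ n)
    (hd0 : 0 < d) (hd : d < b) :
    n + 1 + (positions b r).headD 0 ≤ muRing b α (r + b ^ n * d) := by
  rw [muRing, mu, positions_eq_map_digitSupport b (_ + _), digitSupport_add_mul hb hr hd0 hd,
    List.map_cons, ← positions_eq_map_digitSupport]
  obtain ⟨β, rfl⟩ := Nat.exists_eq_add_of_le' hα
  cases positions b r with
  | nil => simp
  | cons p l =>
    simp only [List.headD_eq_head?_getD, List.head?_cons, Option.getD_some, List.take_succ_cons,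
      List.sum_cons, List.length_cons, Nat.reduceSubDiff, List.getLastD_eq_getLast?,
      List.getLast?_cons_cons]
    omega

theorem rRingRing2_pos (hb : 0 < b) (α k : ℕ) : 0 < rRingRing2 b α k := by
  rw [rRingRing2]
  positivity

theorem rRing2_eq_sq (b α k : ℕ) : rRing2 b α k = rRingRing2 b α k ^ 2 := by
  rw [rRing2, rRingRing2, inv_pow, ← pow_mul, mul_comm]

theorem rRing2_nonneg (b α k : ℕ) : 0 ≤ rRing2 b α k := rRing2_eq_sq b α k ▸ sq_nonneg _

theorem rRing2_le_rRingRing2 (hb : 0 < b) (α k : ℕ) : rRing2 b α k ≤ rRingRing2 b α k := by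
  have hle : rRingRing2 b α k ≤ 1 := inv_le_one_of_one_le₀ (one_le_pow₀ (Nat.one_le_cast.mpr hb))
  rw [rRing2_eq_sq]
  exact pow_le_of_le_one (rRingRing2_pos hb α k).le hle two_ne_zero

/-! ### Summability of the weights -/

theorem sum_range_pow_le (hb : 0 < b) {f g : ℕ → ℝ} (hg : ∀ r, 0 ≤ g r)
    (hfg : ∀ m r d, r < b ^ m → 0 < d → d < b → f (r + b ^ m * d) ≤ ((b : ℝ) ^ (m + 1))⁻¹ * g r)
    (n : ℕ) :
    ∑ k ∈ Finset.range (b ^ n), f k ≤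
      f 0 + ∑ m ∈ Finset.range n, ((b : ℝ) ^ m)⁻¹ * ∑ r ∈ Finset.range (b ^ m), g r := by
  induction n with
  | zero => simp
  | succ n ih =>
    obtain ⟨c, rfl⟩ := Nat.exists_eq_succ_of_ne_zero hb.ne'
    set S := ∑ r ∈ Finset.range ((c + 1) ^ n), g r
    have hS : 0 ≤ S := Finset.sum_nonneg fun r _ => hg r
    have hblock : ∀ d ∈ Finset.range c, ∑ r ∈ Finset.range ((c + 1) ^ n),
        f (r + (c + 1) ^ n * (d + 1)) ≤ (((c + 1 : ℕ) : ℝ) ^ (n + 1))⁻¹ * S := fun d hd => by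
      have hd := Finset.mem_range.mp hd
      rw [Finset.mul_sum]
      exact Finset.sum_le_sum fun r hr =>
        hfg n r (d + 1) (Finset.mem_range.mp hr) d.succ_pos (by omega)
    have hnew : ∑ d ∈ Finset.range c, ∑ r ∈ Finset.range ((c + 1) ^ n),
        f (r + (c + 1) ^ n * (d + 1)) ≤ (((c + 1 : ℕ) : ℝ) ^ n)⁻¹ * S :=
      calc _ ≤ c * ((((c + 1 : ℕ) : ℝ) ^ (n + 1))⁻¹ * S) :=
            (Finset.sum_le_sum hblock).trans_eq (by simp)
        _ ≤ ((c + 1 : ℕ) : ℝ) * ((((c + 1 : ℕ) : ℝ) ^ (n + 1))⁻¹ * S) := by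
            gcongr
            exact c.le_succ
        _ = (((c + 1 : ℕ) : ℝ) ^ n)⁻¹ * S := by
            rw [pow_succ', mul_inv, mul_assoc, mul_inv_cancel_left₀ (Nat.cast_ne_zero.mpr hb.ne')]
    rw [pow_succ, sum_range_mul, Finset.sum_range_succ', Finset.sum_range_succ, add_comm,
      ← add_assoc]
    simp only [mul_zero, add_zero]
    exact add_le_add ih hnew

theorem sum_inv_pow_headD_positions_le (hb : 2 ≤ b) (n : ℕ) :
    ∑ k ∈ Finset.range (b ^ n), ((b : ℝ) ^ (positions b k).headD 0)⁻¹ ≤ n + 1 := by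
  have hb0 : (b : ℝ) ≠ 0 := Nat.cast_ne_zero.mpr (by omega)
  refine (sum_range_pow_le (by omega) (g := 1) (fun _ => zero_le_one) (fun m r d hr hd0 hd => ?_)
    n).trans_eq ?_
  · rw [positions_eq_map_digitSupport, digitSupport_add_mul hb hr hd0 hd, List.map_cons,
      List.headD_cons, Pi.one_apply, mul_one]
  · simp [positions, hb0, add_comm]

theorem sum_rRingRing2_le (hb : 2 ≤ b) {α : ℕ} (hα : 2 ≤ α) (n : ℕ) :
    ∑ k ∈ Finset.range (b ^ n), rRingRing2 b α k ≤
      1 + ∑ m ∈ Finset.range n, (m + 1) * (b : ℝ)⁻¹ ^ m := by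
  have hb1 : (1 : ℝ) ≤ b := Nat.one_le_cast.mpr (by omega)
  have hzero : rRingRing2 b α 0 = 1 := by rw [rRingRing2, muRing_zero, pow_zero, inv_one]
  have hbound := sum_range_pow_le (b := b) (by omega) (f := rRingRing2 b α)
    (g := fun r => ((b : ℝ) ^ (positions b r).headD 0)⁻¹) (fun r => by positivity)
    (fun m r d hr hd0 hd => ?_) n
  · rw [hzero] at hbound
    refine hbound.trans ?_
    gcongr 1 + ∑ m ∈ _, ?_ with m
    rw [mul_comm, inv_pow]
    gcongr
    exact sum_inv_pow_headD_positions_le hb m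
  · rw [← mul_inv, ← pow_add]
    exact inv_anti₀ (by positivity)
      (pow_le_pow_right₀ hb1 (add_headD_positions_le_muRing hb hα hr hd0 hd))

theorem summable_rRingRing2 (hb : 2 ≤ b) {α : ℕ} (hα : 2 ≤ α) : Summable (rRingRing2 b α) := by
  have hnorm : ‖(b : ℝ)⁻¹‖ < 1 := by
    rw [norm_inv, Real.norm_natCast]
    exact inv_lt_one_of_one_lt₀ (Nat.one_lt_cast.mpr hb)
  have hgeom : Summable fun m : ℕ => ((m : ℝ) + 1) * (b : ℝ)⁻¹ ^ m := by
    simpa [add_mul] using (summable_pow_mul_geometric_of_norm_lt_one 1 hnorm).add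
      (summable_geometric_of_norm_lt_one hnorm)
  have hpos := rRingRing2_pos (b := b) (by omega) α
  refine summable_of_sum_range_le (c := 1 + ∑' m : ℕ, ((m : ℝ) + 1) * (b : ℝ)⁻¹ ^ m)
    (fun k => (hpos k).le) fun n => ?_
  calc ∑ k ∈ Finset.range n, rRingRing2 b α k
      ≤ ∑ k ∈ Finset.range (b ^ n), rRingRing2 b α k :=
        Finset.sum_le_sum_of_subset_of_nonneg (Finset.range_mono (Nat.lt_pow_self hb).le)
          fun k _ _ => (hpos k).le
    _ ≤ 1 + ∑ m ∈ Finset.range n, (m + 1) * (b : ℝ)⁻¹ ^ m := sum_rRingRing2_le hb hα n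
    _ ≤ _ := by
        gcongr
        exact hgeom.sum_le_tsum _ fun m _ => by positivity

theorem summable_rRing2 (hb : 2 ≤ b) {α : ℕ} (hα : 2 ≤ α) : Summable (rRing2 b α) :=
  (summable_rRingRing2 hb hα).of_nonneg_of_le (rRing2_nonneg b α)
    (rRing2_le_rRingRing2 (by omega) α)

/-! ### The leading positions -/

theorem exists_finset_eq_take_sum {l : List ℕ} (hl : l.SortedGT) (hne : l ≠ []) {α : ℕ}
    (hα : 1 ≤ α) :
    ∃ T : Finset ℕ, ∃ m ∈ T, (∀ a ∈ T, m ≤ a ∧ a ∈ l) ∧ T.card ≤ α ∧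
      (T.card < α → ∀ j ∈ l, m ≤ j) ∧
      ((l.map (· + 1)).take α).sum + (α - (l.map (· + 1)).length) * (l.map (· + 1)).getLastD 0 =
        ∑ a ∈ T, (a + 1) + (α - T.card) * (m + 1) := by
  set Q := l.take α with hQ
  have hQne : Q ≠ [] := by
    rw [hQ, Ne, List.take_eq_nil_iff]
    exact fun h => h.elim (by omega) hne
  have hQsorted : Q.SortedGT := (hl.pairwise.sublist (List.take_sublist α l)).sortedGT
  have hcard : Q.toFinset.card = min α l.length := by
    rw [List.toFinset_card_of_nodup hQsorted.nodup, hQ, List.length_take]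
  have hlast : ∀ a ∈ Q, Q.getLast hQne ≤ a := fun a ha =>
    hQsorted.sortedGE.pairwise.rel_getLast ha
  have hfull (hlt : Q.toFinset.card < α) : Q = l := List.take_of_length_le (by omega)
  refine ⟨Q.toFinset, Q.getLast hQne, by simp, fun a ha => ?_, by omega, fun hlt j hj => ?_, ?_⟩
  · rw [List.mem_toFinset] at ha
    exact ⟨hlast a ha, List.mem_of_mem_take ha⟩
  · exact hlast j (hfull hlt ▸ hj)
  · rw [← List.map_take, ← hQ, List.sum_toFinset _ hQsorted.nodup, List.length_map]
    congr 1
    rcases le_or_gt α l.length with hle | hlt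
    · rw [Nat.sub_eq_zero_of_le hle, Nat.sub_eq_zero_of_le (by omega), zero_mul, zero_mul]
    · have hQl : Q = l := hfull (by omega)
      rw [hcard, min_eq_right hlt.le, List.getLastD_eq_getLast?, List.getLast?_map, ← hQl,
        List.getLast?_eq_getLast_of_ne_nil hQne]
      rfl

theorem exists_muRing_eq (hb : 2 ≤ b) {α k : ℕ} (hα : 1 ≤ α) (hk : k ≠ 0) :
    ∃ T : Finset ℕ, ∃ m ∈ T, (∀ a ∈ T, m ≤ a ∧ natDigit b k a ≠ 0) ∧ T.card ≤ α ∧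
      (T.card < α → ∀ j < m, natDigit b k j = 0) ∧
      muRing b α k = ∑ a ∈ T, (a + 1) + (α - T.card) * (m + 1) := by
  obtain ⟨T, m, hm, hT, hcard, hlow, hsum⟩ :=
    exists_finset_eq_take_sum (sortedGT_digitSupport b k) (digitSupport_ne_nil hb hk) hα
  simp only [mem_digitSupport hb] at hT hlow
  refine ⟨T, m, hm, hT, hcard, fun hlt j hj => ?_, hsum⟩
  by_contra hne
  exact hj.not_ge (hlow hlt j hne)

end Weights

/-! ### Decay of the Walsh coefficients -/

section Decay

variable {b : ℕ}

theorem prod_div_pow_mul_pow_eq {α k m : ℕ} {T : Finset ℕ} (hcard : T.card ≤ α)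
    (hmu : muRing b α k = ∑ a ∈ T, (a + 1) + (α - T.card) * (m + 1)) (A : ℝ) :
    (∏ a ∈ T, A / b ^ (a + 1)) * (A / b ^ (m + 1)) ^ (α - T.card) = A ^ α * rRingRing2 b α k := by
  rw [Finset.prod_div_distrib, Finset.prod_const, Finset.prod_pow_eq_pow_sum, div_pow,
    div_mul_div_comm, ← pow_add, Nat.add_sub_cancel' hcard, ← pow_mul, ← pow_add, rRingRing2, hmu,
    mul_comm (m + 1), div_eq_mul_inv]

variable [NeZero b]

theorem norm_walshCoeff_le_mul_prod {m n : ℕ} {T : Finset ℕ} (hmn : m ≤ n)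
    (hT : ∀ a ∈ T, m ≤ a ∧ a < n) (t : ℝ) (k : ℕ) :
    ‖walshCoeff b n t k‖ ≤
      ‖walshCoeff b m t k‖ * ∏ a ∈ T, ‖dirichletMean b (t / b ^ a - natDigit b k a)‖ := by
  have hdisj : Disjoint (Finset.range m) T := Finset.disjoint_left.mpr fun a ha haT =>
    (Finset.mem_range.mp ha).not_ge (hT a haT).1
  have hsub : Finset.range m ∪ T ⊆ Finset.range n :=
    Finset.union_subset (Finset.range_mono hmn) fun a ha => Finset.mem_range.mpr (hT a ha).2
  rw [walshCoeff, walshCoeff, norm_prod, norm_prod, ← Finset.prod_union hdisj]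
  exact Finset.prod_le_prod_of_subset_of_le_one hsub (fun _ _ => norm_nonneg _)
    fun _ _ _ => norm_dirichletMean_le_one b _

theorem prod_norm_dirichletMean_mul_le {k m : ℕ} {T : Finset ℕ} (hm : m ∈ T)
    (hT : ∀ a ∈ T, natDigit b k a ≠ 0) (t : ℝ) :
    (∏ a ∈ T, ‖dirichletMean b (t / b ^ a - natDigit b k a)‖) * (1 + |t| / b ^ m) ≤
      ∏ a ∈ T, (2 * Real.pi + 1) * b * |t| / b ^ (a + 1) := by
  have hb : (0 : ℝ) < b := Nat.cast_pos.mpr (NeZero.pos b)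
  have hcancel (a : ℕ) :
      (2 * Real.pi + 1) * b * |t| / (b : ℝ) ^ (a + 1) = (2 * Real.pi + 1) * (|t| / b ^ a) := by
    rw [pow_succ]
    field_simp
  have hfactor : ∀ a ∈ T,
      ‖dirichletMean b (t / b ^ a - natDigit b k a)‖ ≤ 2 * Real.pi * (|t| / b ^ a) := fun a ha => by
    refine (norm_dirichletMean_sub_natCast_le b _ (hT a ha)
      (natDigit_lt (NeZero.pos b) k a)).trans_eq ?_
    rw [abs_div, abs_of_pos (pow_pos hb a)]
  simp only [hcancel]
  rw [← Finset.mul_prod_erase _ _ hm, ← Finset.mul_prod_erase _ _ hm, mul_right_comm]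
  refine mul_le_mul ?_ (Finset.prod_le_prod (fun _ _ => norm_nonneg _) fun a ha => ?_)
    (Finset.prod_nonneg fun _ _ => norm_nonneg _) (by positivity)
  · linarith [hfactor m hm, mul_le_of_le_one_left (show 0 ≤ |t| / (b : ℝ) ^ m by positivity)
      (norm_dirichletMean_le_one b (t / b ^ m - natDigit b k m))]
  · refine (hfactor a (Finset.mem_of_mem_erase ha)).trans ?_
    gcongr
    linarith

theorem one_le_of_pow_dvd {m : ℕ} {h : ℤ} (hh : h ≠ 0) (hdvd : (b : ℤ) ^ m ∣ h) :
    1 ≤ (2 * Real.pi + 1) * b * |(h : ℝ)| / b ^ (m + 1) := by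
  have hb : (0 : ℝ) < b := Nat.cast_pos.mpr (NeZero.pos b)
  have hle : (b : ℝ) ^ m ≤ |(h : ℝ)| := by
    exact_mod_cast Int.le_of_dvd (abs_pos.mpr hh) ((dvd_abs _ _).mpr hdvd)
  rw [one_le_div (by positivity), pow_succ']
  calc (b : ℝ) * b ^ m ≤ b * |(h : ℝ)| := by gcongr
    _ ≤ (2 * Real.pi + 1) * (b * |(h : ℝ)|) :=
        le_mul_of_one_le_left (by positivity) (by linarith [Real.pi_pos])
    _ = _ := (mul_assoc _ _ _).symm

/- The factor `‖walshCoeff b m h k‖` is periodic in `h` with mean square `b ^ (-m)`: keeping it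
makes the sum over `h` of the squared coefficients decay like `rRing2`. -/
theorem exists_norm_walshCoeff_mul_le (hb : 2 ≤ b) {α n k : ℕ} (hα : 1 ≤ α) (hk : k ≠ 0)
    (hkn : k < b ^ n) :
    ∃ m : ℕ, ∀ h : ℤ, h ≠ 0 → ‖walshCoeff b n h k‖ * (1 + |(h : ℝ)| / b ^ m) ≤
      ((2 * Real.pi + 1) * b * |(h : ℝ)|) ^ α * rRingRing2 b α k * ‖walshCoeff b m h k‖ := by
  obtain ⟨T, m, hm, hT, hcard, hlow, hmu⟩ := exists_muRing_eq hb hα hk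
  have hTn : ∀ a ∈ T, m ≤ a ∧ a < n := fun a ha => ⟨(hT a ha).1, by
    by_contra! hna
    exact (hT a ha).2 (natDigit_eq_zero (by omega) hkn hna)⟩
  refine ⟨m, fun h hh => ?_⟩
  set A := (2 * Real.pi + 1) * b * |(h : ℝ)|
  have hpad : ‖walshCoeff b m h k‖ ≤
      ‖walshCoeff b m h k‖ * (A / b ^ (m + 1)) ^ (α - T.card) := by
    rcases hcard.lt_or_eq with hlt | heq
    · by_cases hc : walshCoeff b m h k = 0
      · simp [hc]
      · exact le_mul_of_one_le_right (norm_nonneg _)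
          (one_le_pow₀ (one_le_of_pow_dvd hh (pow_dvd_of_walshCoeff_ne_zero (hlow hlt) hc)))
    · simp [heq]
  calc ‖walshCoeff b n h k‖ * (1 + |(h : ℝ)| / b ^ m)
      ≤ ‖walshCoeff b m h k‖ *
          (∏ a ∈ T, ‖dirichletMean b (h / b ^ a - natDigit b k a)‖) * (1 + |(h : ℝ)| / b ^ m) := by
        gcongr
        exact norm_walshCoeff_le_mul_prod (hTn m hm).2.le hTn h k
    _ ≤ ‖walshCoeff b m h k‖ * ∏ a ∈ T, A / b ^ (a + 1) := by
        rw [mul_assoc]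
        gcongr
        exact prod_norm_dirichletMean_mul_le hm (fun a ha => (hT a ha).2) h
    _ ≤ ‖walshCoeff b m h k‖ * (A / b ^ (m + 1)) ^ (α - T.card) * ∏ a ∈ T, A / b ^ (a + 1) := by
        gcongr
    _ = A ^ α * rRingRing2 b α k * ‖walshCoeff b m h k‖ := by
        rw [mul_assoc, mul_comm, mul_comm (_ ^ _), prod_div_pow_mul_pow_eq hcard hmu]

end Decay

/-! ### Sums over frequencies -/

theorem summable_inv_max_one_sq : Summable fun q : ℤ => (max 1 |(q : ℝ)| ^ 2)⁻¹ := by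
  have hsum := (Real.summable_one_div_int_pow (p := 2)).mpr one_lt_two
  refine (hsum.add (hasSum_ite_eq (0 : ℤ) (1 : ℝ)).summable).of_nonneg_of_le
    (fun q => by positivity) fun q => ?_
  rcases eq_or_ne q 0 with rfl | hq
  · simp
  · have : 0 < |(q : ℝ)| := abs_pos.mpr (Int.cast_ne_zero.mpr hq)
    rw [if_neg hq, add_zero, one_div, ← sq_abs (q : ℝ)]
    gcongr
    exact le_max_right _ _

theorem max_one_abs_le {N r : ℕ} (hr : r < N) (q : ℤ) :
    max 1 |(q : ℝ)| ≤ 1 + |(r + N * q : ℝ)| / N := by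
  have hN : (0 : ℝ) < N := Nat.cast_pos.mpr (by omega)
  have hr1 : (r : ℝ) / N ≤ 1 := (div_le_one hN).mpr (Nat.cast_le.mpr hr.le)
  have hq : (q : ℝ) = (r + N * q) / N - r / N := by field_simp; ring
  refine max_le (le_add_of_nonneg_right (by positivity)) ?_
  calc |(q : ℝ)| ≤ |(r + N * q : ℝ) / N| + |(r : ℝ) / N| := by
        conv_lhs => rw [hq]
        exact abs_sub _ _
    _ ≤ |(r + N * q : ℝ)| / N + 1 := by
        rw [abs_div, Nat.abs_cast, abs_of_nonneg (by positivity : (0 : ℝ) ≤ r / N)]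
        gcongr
    _ = _ := add_comm _ _

theorem summable_and_tsum_le_of_periodic {N : ℕ} [NeZero N] {f : ℤ → ℝ} (hf : ∀ h, 0 ≤ f h)
    (hper : ∀ h q : ℤ, f (h + N * q) = f h) :
    (Summable fun h : ℤ => f h * ((1 + |(h : ℝ)| / N) ^ 2)⁻¹) ∧
      ∑' h : ℤ, f h * ((1 + |(h : ℝ)| / N) ^ 2)⁻¹ ≤
        (∑' q : ℤ, (max 1 |(q : ℝ)| ^ 2)⁻¹) * ∑ r ∈ Finset.range N, f r := by
  let E : ℤ × Fin N ≃ ℤ := (Int.divModEquiv N).symm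
  have hE (q : ℤ) (r : Fin N) : E (q, r) = (r : ℕ) + N * q := by
    simp only [E, Int.divModEquiv_symm_apply]
    ring
  have hfin : Summable fun r : Fin N => f (r : ℕ) := Summable.of_finite
  have hprod : Summable fun x : ℤ × Fin N => (max 1 |(x.1 : ℝ)| ^ 2)⁻¹ * f (x.2 : ℕ) :=
    summable_inv_max_one_sq.mul_of_nonneg hfin (fun q => by positivity) fun r => hf _
  have hle : ∀ x : ℤ × Fin N, f (E x) * ((1 + |((E x : ℤ) : ℝ)| / N) ^ 2)⁻¹ ≤
      (max 1 |(x.1 : ℝ)| ^ 2)⁻¹ * f (x.2 : ℕ) := by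
    rintro ⟨q, r⟩
    rw [hE, hper, mul_comm]
    have hfr := hf (r : ℕ)
    gcongr
    simpa using max_one_abs_le r.2 q
  have hsummable := hprod.of_nonneg_of_le (fun x => mul_nonneg (hf _) (by positivity)) hle
  refine ⟨E.summable_iff.mp hsummable, ?_⟩
  calc ∑' h : ℤ, f h * ((1 + |(h : ℝ)| / N) ^ 2)⁻¹
      = ∑' x, f (E x) * ((1 + |((E x : ℤ) : ℝ)| / N) ^ 2)⁻¹ := (E.tsum_eq _).symm
    _ ≤ ∑' x : ℤ × Fin N, (max 1 |(x.1 : ℝ)| ^ 2)⁻¹ * f (x.2 : ℕ) := hsummable.tsum_mono hprod hle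
    _ = (∑' q : ℤ, (max 1 |(q : ℝ)| ^ 2)⁻¹) * ∑' r : Fin N, f (r : ℕ) :=
        (summable_inv_max_one_sq.tsum_mul_tsum hfin hprod).symm
    _ = _ := by
        rw [tsum_fintype fun r : Fin N => f (r : ℕ), Fin.sum_univ_eq_sum_range fun r : ℕ => f r]

section WalshMass

theorem inv_pow_two_mul_nonneg (α : ℕ) (t : ℝ) : 0 ≤ (t ^ (2 * α))⁻¹ :=
  inv_nonneg.mpr ((even_two_mul α).pow_nonneg _)

theorem summable_inv_pow_two_mul {α : ℕ} (hα : 1 ≤ α) :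
    Summable fun h : ℤ => ((h : ℝ) ^ (2 * α))⁻¹ := by
  simpa using (Real.summable_one_div_int_pow (p := 2 * α)).mpr (by omega)

/-- The `k`-th Walsh coefficients of the truncated characters `e(h · trunc n)`, in mean square with
the Korobov weights. The term `h = 0` vanishes for `α ≠ 0` because `0⁻¹ = 0`. -/
def walshMass (b α n k : ℕ) : ℝ := ∑' h : ℤ, ((h : ℝ) ^ (2 * α))⁻¹ * ‖walshCoeff b n h k‖ ^ 2

variable {b : ℕ} [NeZero b]

theorem walshMass_term_le (α n k : ℕ) (h : ℤ) :
    ((h : ℝ) ^ (2 * α))⁻¹ * ‖walshCoeff b n h k‖ ^ 2 ≤ ((h : ℝ) ^ (2 * α))⁻¹ :=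
  mul_le_of_le_one_right (inv_pow_two_mul_nonneg α h)
    (pow_le_one₀ (norm_nonneg _) (norm_walshCoeff_le_one n h k))

theorem summable_walshMass {α : ℕ} (hα : 1 ≤ α) (n k : ℕ) :
    Summable fun h : ℤ => ((h : ℝ) ^ (2 * α))⁻¹ * ‖walshCoeff b n h k‖ ^ 2 :=
  (summable_inv_pow_two_mul hα).of_nonneg_of_le
    (fun h => mul_nonneg (inv_pow_two_mul_nonneg α h) (sq_nonneg _)) (walshMass_term_le α n k)

theorem tendsto_walshMass_zero (hb : 2 ≤ b) {α : ℕ} (hα : 1 ≤ α) :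
    Tendsto (fun n => walshMass b α n 0) atTop (𝓝 0) := by
  have hpoint (h : ℤ) :
      Tendsto (fun n => ((h : ℝ) ^ (2 * α))⁻¹ * ‖walshCoeff b n h 0‖ ^ 2) atTop (𝓝 0) := by
    rcases eq_or_ne h 0 with rfl | hh
    · simp [show α ≠ 0 by omega]
    refine tendsto_const_nhds.congr' ?_
    filter_upwards [eventually_gt_atTop h.natAbs] with n hn
    have hzero : walshCoeff b n h 0 = 0 := by
      by_contra hc
      have hdvd := Int.natAbs_dvd_natAbs.mpr
        (pow_dvd_of_walshCoeff_ne_zero (fun j _ => natDigit_zero_left b j) hc)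
      rw [Int.natAbs_pow, Int.natAbs_natCast] at hdvd
      have hle := Nat.le_of_dvd (Int.natAbs_pos.mpr hh) hdvd
      exact absurd (hn.trans (Nat.lt_pow_self hb)) hle.not_gt
    simp [hzero]
  simpa [walshMass] using tendsto_tsum_of_dominated_convergence (summable_inv_pow_two_mul hα) hpoint
    (Eventually.of_forall fun n h => (Real.norm_of_nonneg
      (mul_nonneg (inv_pow_two_mul_nonneg α h) (sq_nonneg _))).trans_le (walshMass_term_le α n 0 h))

theorem exists_walshMass_le (hb : 2 ≤ b) {α : ℕ} (hα : 1 ≤ α) :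
    ∃ D : ℝ, 0 ≤ D ∧ ∀ n k, k ≠ 0 → k < b ^ n → walshMass b α n k ≤ D * rRing2 b α k := by
  set A : ℝ := (2 * Real.pi + 1) * b
  have : 0 ≤ ∑' q : ℤ, (max 1 |(q : ℝ)| ^ 2)⁻¹ := tsum_nonneg fun q => by positivity
  refine ⟨(A ^ α) ^ 2 * ∑' q : ℤ, (max 1 |(q : ℝ)| ^ 2)⁻¹, by positivity, fun n k hk hkn => ?_⟩
  obtain ⟨m, hm⟩ := exists_norm_walshCoeff_mul_le hb hα hk hkn
  obtain ⟨hsummable, hle⟩ := summable_and_tsum_le_of_periodic (N := b ^ m)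
    (f := fun h => ‖walshCoeff b m h k‖ ^ 2) (fun h => sq_nonneg _) fun h q => by
      push_cast
      rw [walshCoeff_add_mul]
  simp only [Nat.cast_pow, Int.cast_natCast, sum_norm_sq_walshCoeff, mul_one] at hsummable hle
  have hterm (h : ℤ) : ((h : ℝ) ^ (2 * α))⁻¹ * ‖walshCoeff b n h k‖ ^ 2 ≤
      (A ^ α) ^ 2 * rRing2 b α k *
        (‖walshCoeff b m h k‖ ^ 2 * ((1 + |(h : ℝ)| / b ^ m) ^ 2)⁻¹) := by
    rcases eq_or_ne h 0 with rfl | hh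
    · have := rRing2_nonneg b α k
      rw [Int.cast_zero, zero_pow (by omega), inv_zero, zero_mul]
      positivity
    have : 0 < |(h : ℝ)| := abs_pos.mpr (Int.cast_ne_zero.mpr hh)
    have hsq := pow_le_pow_left₀ (by positivity) (hm h hh) 2
    have heven : (h : ℝ) ^ (2 * α) = (|(h : ℝ)| ^ α) ^ 2 := by
      rw [← pow_mul, mul_comm α, (even_two_mul α).pow_abs]
    rw [heven, rRing2_eq_sq, ← mul_assoc, inv_mul_le_iff₀ (by positivity), ← div_eq_mul_inv,
      mul_div_assoc', le_div_iff₀ (by positivity), ← mul_pow]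
    refine hsq.trans_eq ?_
    rw [mul_pow A]
    ring
  calc walshMass b α n k
      ≤ ∑' h : ℤ, (A ^ α) ^ 2 * rRing2 b α k *
          (‖walshCoeff b m h k‖ ^ 2 * ((1 + |(h : ℝ)| / b ^ m) ^ 2)⁻¹) :=
        (summable_walshMass hα n k).tsum_mono (hsummable.mul_left _) hterm
    _ ≤ (A ^ α) ^ 2 * rRing2 b α k * ∑' q : ℤ, (max 1 |(q : ℝ)| ^ 2)⁻¹ := by
        have := rRing2_nonneg b α k
        rw [tsum_mul_left]
        gcongr
    _ = _ := by ring

end WalshMass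

/-! ### The Korobov kernel -/

section Korobov

variable {α : ℕ}

theorem norm_inv_pow_mul_cos_le (α : ℕ) (t s : ℝ) :
    ‖(t ^ (2 * α))⁻¹ * Real.cos s‖ ≤ (t ^ (2 * α))⁻¹ := by
  rw [norm_mul, Real.norm_of_nonneg (inv_pow_two_mul_nonneg α t)]
  exact mul_le_of_le_one_right (inv_pow_two_mul_nonneg α t) (Real.abs_cos_le_one s)

theorem summable_subtype_inv_pow_two_mul (hα : 1 ≤ α) :
    Summable fun h : {h : ℤ // h ≠ 0} => ((h : ℝ) ^ (2 * α))⁻¹ :=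
  (summable_inv_pow_two_mul hα).subtype {h : ℤ | h ≠ 0}

theorem norm_korobov_le (hα : 1 ≤ α) (x y : ℝ) :
    ‖korobov α x y‖ ≤ ∑' h : {h : ℤ // h ≠ 0}, ((h : ℝ) ^ (2 * α))⁻¹ :=
  tsum_of_norm_bounded (summable_subtype_inv_pow_two_mul hα).hasSum fun _ =>
    norm_inv_pow_mul_cos_le α _ _

theorem continuous_korobov (hα : 1 ≤ α) : Continuous (korobov α).uncurry :=
  continuous_tsum (fun _ => by fun_prop) (summable_subtype_inv_pow_two_mul hα) fun _ _ =>
    norm_inv_pow_mul_cos_le α _ _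

theorem hasSum_korobov (hα : 1 ≤ α) (x y : ℝ) :
    HasSum (fun h : ℤ => ((h : ℝ) ^ (2 * α))⁻¹ * (e (h * x) * conj (e (h * y))).re)
      (korobov α x y) := by
  have hsupp : (Function.support fun h : ℤ => ((h : ℝ) ^ (2 * α))⁻¹ *
      (e (h * x) * conj (e (h * y))).re) ⊆ {h : ℤ | h ≠ 0} := by
    rintro h hh rfl
    simp [show α ≠ 0 by omega] at hh
  rw [← hasSum_subtype_iff_of_support_subset hsupp]
  refine (Summable.of_norm_bounded (summable_subtype_inv_pow_two_mul hα) fun _ =>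
    norm_inv_pow_mul_cos_le α _ _).hasSum.congr_fun fun h => ?_
  rw [Function.comp_apply, conj_e, ← AddChar.map_add_eq_mul, re_e]
  congr 2
  ring

theorem posSemidef_korobov (hα : 1 ≤ α) : (Matrix.of (korobov α)).PosSemidef :=
  posSemidef_of_hasSum (fun h : ℤ => inv_pow_two_mul_nonneg α h) (hasSum_korobov hα)

theorem isSPSD_of_posSemidef {K : ℝ → ℝ → ℝ} (hK : (Matrix.of K).PosSemidef) : IsSPSD K :=
  hK.submatrix ((↑) : I → ℝ)

theorem hasSum_quadForm_korobov {X : Type*} (hα : 1 ≤ α) (p : X → ℝ) (a : X →₀ ℝ) :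
    HasSum (fun h : ℤ => ((h : ℝ) ^ (2 * α))⁻¹ * ‖pairing a fun x => e (h * p x)‖ ^ 2)
      (quadForm (fun x y => korobov α (p x) (p y)) a) :=
  hasSum_quadForm (fun x y => hasSum_korobov hα (p x) (p y)) a

end Korobov

theorem tendsto_comp_trunc {b : ℕ} {K : ℝ → ℝ → ℝ} (hK : Continuous K.uncurry)
    (d d' : ℕ → Fin b) :
    Tendsto (fun n => K (trunc n d) (trunc n d')) atTop
      (𝓝 (K (Real.ofDigits d) (Real.ofDigits d'))) :=
  (hK.tendsto (_, _)).comp ((tendsto_trunc d).prodMk_nhds (tendsto_trunc d'))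

/-! ### The Korobov kernel and Walsh kernels -/

section Comparison

variable {b : ℕ} [NeZero b]

theorem isSPSD_kRing (hb : 2 ≤ b) {α : ℕ} (hα : 2 ≤ α) : IsSPSD (kRing b α) :=
  isSPSD_walshKernel hb (summable_rRing2 hb hα) (rRing2_nonneg b α)

theorem isSPSD_kRingRing (hb : 2 ≤ b) {α : ℕ} (hα : 2 ≤ α) : IsSPSD (kRingRing b α) :=
  isSPSD_walshKernel hb (summable_rRingRing2 hb hα) fun k => (rRingRing2_pos (NeZero.pos b) α k).le

theorem quadForm_kRing_le (hb : 2 ≤ b) {α : ℕ} (hα : 2 ≤ α) (a : I →₀ ℝ) :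
    quadForm (onI (kRing b α)) a ≤ quadForm (onI (kRingRing b α)) a :=
  quadForm_walshKernel_mono hb (summable_rRing2 hb hα) (summable_rRingRing2 hb hα)
    (rRing2_le_rRingRing2 (NeZero.pos b) α) a

theorem norm_sq_sum_mul_le {ι : Type*} {s : Finset ι} {r : ι → ℝ} (hr : ∀ i, 0 < r i)
    (u v : ι → ℂ) :
    ‖∑ i ∈ s, u i * v i‖ ^ 2 ≤ (∑ i ∈ s, (r i)⁻¹ * ‖u i‖ ^ 2) * ∑ i ∈ s, r i * ‖v i‖ ^ 2 := by
  refine (pow_le_pow_left₀ (norm_nonneg _) (norm_sum_le _ _) 2).trans ?_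
  refine Finset.sum_sq_le_sum_mul_sum_of_sq_le_mul s
    (fun i _ => mul_nonneg (inv_nonneg.mpr (hr i).le) (sq_nonneg _))
    (fun i _ => mul_nonneg (hr i).le (sq_nonneg _)) fun i _ => le_of_eq ?_
  rw [norm_mul, mul_pow, mul_mul_mul_comm, inv_mul_cancel₀ (hr i).ne', one_mul]

theorem norm_sq_sum_range_mul_le {N : ℕ} (hN : 0 < N) {r : ℕ → ℝ} (hr : ∀ k, 0 < r k)
    (u v : ℕ → ℂ) :
    ‖∑ k ∈ Finset.range N, u k * v k‖ ^ 2 ≤ 2 * (‖u 0‖ ^ 2 * ‖v 0‖ ^ 2 +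
      (∑ k ∈ Finset.Ico 1 N, (r k)⁻¹ * ‖u k‖ ^ 2) * ∑ k ∈ Finset.Ico 1 N, r k * ‖v k‖ ^ 2) := by
  rw [Finset.range_eq_Ico, Finset.sum_eq_sum_Ico_succ_bot hN, zero_add]
  calc ‖u 0 * v 0 + ∑ k ∈ Finset.Ico 1 N, u k * v k‖ ^ 2
      ≤ (‖u 0 * v 0‖ + ‖∑ k ∈ Finset.Ico 1 N, u k * v k‖) ^ 2 := by
        gcongr
        exact norm_add_le _ _
    _ ≤ 2 * (‖u 0 * v 0‖ ^ 2 + ‖∑ k ∈ Finset.Ico 1 N, u k * v k‖ ^ 2) := add_sq_le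
    _ ≤ _ := by
        rw [norm_mul, mul_pow]
        gcongr
        exact norm_sq_sum_mul_le hr u v

theorem quadForm_korobov_trunc_le (hb : 2 ≤ b) {α : ℕ} (hα : 1 ≤ α) {r : ℕ → ℝ}
    (hr : ∀ k, 0 < r k) (n : ℕ) (a : I →₀ ℝ) :
    quadForm (fun x y : I => korobov α (trunc n (Real.digits x b)) (trunc n (Real.digits y b))) a ≤
      2 * (walshMass b α n 0 * ‖walshTransform b a 0‖ ^ 2 +
        (∑ k ∈ Finset.Ico 1 (b ^ n), (r k)⁻¹ * walshMass b α n k) *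
          ∑ k ∈ Finset.Ico 1 (b ^ n), r k * ‖walshTransform b a k‖ ^ 2) := by
  have hmass (k : ℕ) := (summable_walshMass (b := b) hα n k).hasSum
  have hmajorant := (((hmass 0).mul_right (‖walshTransform b a 0‖ ^ 2)).add
    ((hasSum_sum fun k (_ : k ∈ Finset.Ico 1 (b ^ n)) => (hmass k).mul_left (r k)⁻¹).mul_right
      (∑ k ∈ Finset.Ico 1 (b ^ n), r k * ‖walshTransform b a k‖ ^ 2))).mul_left 2
  refine hasSum_le (fun h => ?_) (hasSum_quadForm_korobov hα _ a) hmajorant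
  rw [pairing_e_mul_trunc hb]
  refine (mul_le_mul_of_nonneg_left (norm_sq_sum_range_mul_le (Nat.pow_pos (NeZero.pos b)) hr _ _)
    (inv_pow_two_mul_nonneg α h)).trans_eq ?_
  have hfactor : ∑ k ∈ Finset.Ico 1 (b ^ n),
      (r k)⁻¹ * (((h : ℝ) ^ (2 * α))⁻¹ * ‖walshCoeff b n h k‖ ^ 2) = ((h : ℝ) ^ (2 * α))⁻¹ *
        ∑ k ∈ Finset.Ico 1 (b ^ n), (r k)⁻¹ * ‖walshCoeff b n h k‖ ^ 2 := by
    rw [Finset.mul_sum]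
    exact Finset.sum_congr rfl fun k _ => mul_left_comm _ _ _
  rw [hfactor]
  simp only [walshTransform]
  ring

theorem exists_quadForm_korobov_le (hb : 2 ≤ b) {α : ℕ} (hα : 2 ≤ α) :
    ∃ C : ℝ, 0 ≤ C ∧
      ∀ a, quadForm (onI (korobov α)) a ≤ C * quadForm (onI (kRingRing b α)) a := by
  obtain ⟨D, hD, hmass⟩ := exists_walshMass_le hb (show 1 ≤ α by omega)
  have hpos := rRingRing2_pos (NeZero.pos b) α
  have hsum := summable_rRingRing2 hb hα
  have htsum : 0 ≤ ∑' k, rRingRing2 b α k := tsum_nonneg fun k => (hpos k).le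
  refine ⟨2 * (D * ∑' k, rRingRing2 b α k), by positivity, fun a => ?_⟩
  set Q := quadForm (onI (kRingRing b α)) a
  have hleft : Tendsto (fun n => quadForm (fun x y : I =>
      korobov α (trunc n (Real.digits x b)) (trunc n (Real.digits y b))) a) atTop
      (𝓝 (quadForm (onI (korobov α)) a)) := by
    refine tendsto_quadForm (fun x y => ?_) a
    have hlim := tendsto_comp_trunc (continuous_korobov (show 1 ≤ α by omega))
      (Real.digits x b) (Real.digits y b)
    rwa [Real.ofDigits_digits hb x.2, Real.ofDigits_digits hb y.2] at hlim
  have hright : Tendsto (fun n => 2 * (walshMass b α n 0 * ‖walshTransform b a 0‖ ^ 2 +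
      (D * ∑' k, rRingRing2 b α k) * Q)) atTop (𝓝 (2 * (D * ∑' k, rRingRing2 b α k) * Q)) := by
    simpa [mul_assoc] using (((tendsto_walshMass_zero hb (show 1 ≤ α by omega)).mul_const
      (‖walshTransform b a 0‖ ^ 2)).add_const ((D * ∑' k, rRingRing2 b α k) * Q)).const_mul 2
  refine le_of_tendsto_of_tendsto' hleft hright fun n =>
    (quadForm_korobov_trunc_le hb (by omega) hpos n a).trans ?_
  have hweighted : ∑ k ∈ Finset.Ico 1 (b ^ n), (rRingRing2 b α k)⁻¹ * walshMass b α n k ≤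
      D * ∑' k, rRingRing2 b α k := by
    refine (Finset.sum_le_sum fun k hk => ?_).trans
      ((Finset.mul_sum _ _ _).ge.trans (mul_le_mul_of_nonneg_left
        (hsum.sum_le_tsum (Finset.Ico 1 (b ^ n)) fun k _ => (hpos k).le) hD))
    obtain ⟨hk1, hkn⟩ := Finset.mem_Ico.mp hk
    rw [inv_mul_le_iff₀ (hpos k), mul_left_comm, ← sq, ← rRing2_eq_sq]
    exact hmass n k (by omega) hkn
  gcongr
  · exact Finset.sum_nonneg fun k _ => mul_nonneg (hpos k).le (sq_nonneg _)
  · exact sum_Ico_le_quadForm_walshKernel hb hsum (fun k => (hpos k).le) a _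

end Comparison

/-! ### Digital shifts -/

section DigitalShift

variable {b : ℕ} [NeZero b]

theorem integral_comp_floor_mul {N : ℕ} (hN : 0 < N) (ψ : ℕ → ℝ) :
    ∫ σ in (0 : ℝ)..1, ψ ⌊σ * N⌋₊ = (N : ℝ)⁻¹ * ∑ q ∈ Finset.range N, ψ q := by
  have hN : (0 : ℝ) < N := Nat.cast_pos.mpr hN
  have hle (q : ℕ) : (q : ℝ) / N ≤ ((q + 1 : ℕ) : ℝ) / N := by
    gcongr
    exact q.le_succ
  have hconst (q : ℕ) : Set.EqOn (fun σ : ℝ => ψ ⌊σ * N⌋₊) (fun _ => ψ q)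
      (Set.Ioo ((q : ℝ) / N) (((q + 1 : ℕ) : ℝ) / N)) := fun σ hσ => by
    have hσ0 : 0 ≤ σ := (by positivity : (0 : ℝ) ≤ q / N).trans hσ.1.le
    have hfloor : ⌊σ * N⌋₊ = q := (Nat.floor_eq_iff (by positivity)).mpr
      ⟨((div_lt_iff₀ hN).mp hσ.1).le, by exact_mod_cast (lt_div_iff₀ hN).mp hσ.2⟩
    exact congrArg ψ hfloor
  have h_integrable : ∀ q < N, IntervalIntegrable (fun σ : ℝ => ψ ⌊σ * N⌋₊) volume
      ((q : ℝ) / N) (((q + 1 : ℕ) : ℝ) / N) := fun q _ => by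
    refine (intervalIntegrable_const (c := ψ q)).congr_uIoo ?_
    rw [Set.uIoo_of_le (hle q)]
    exact (hconst q).symm
  have hsplit := intervalIntegral.sum_integral_adjacent_intervals
    (a := fun q : ℕ => (q : ℝ) / N) h_integrable
  simp only [Nat.cast_zero, zero_div, div_self hN.ne'] at hsplit
  rw [← hsplit, Finset.mul_sum]
  refine Finset.sum_congr rfl fun q _ => ?_
  rw [intervalIntegral.integral_congr_Ioo_of_le (hle q) (hconst q),
    intervalIntegral.integral_const, smul_eq_mul, ← sub_div, Nat.cast_succ, add_sub_cancel_left,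
    one_div]

/-- The discretization of `dsi b K` to `n` digits: the shifts range over the grid `q / b ^ n` only,
and the digits beyond the `n`-th are dropped. -/
def gridDsi (b : ℕ) [NeZero b] (K : ℝ → ℝ → ℝ) (n : ℕ) (x y : ℝ) : ℝ :=
  ((b : ℝ) ^ n)⁻¹ * ∑ q ∈ Finset.range (b ^ n),
    K (trunc n (Real.digits x b + gridDigits b n q)) (trunc n (Real.digits y b + gridDigits b n q))

theorem gridDsi_eq_integral (K : ℝ → ℝ → ℝ) (n : ℕ) (x y : ℝ) :
    gridDsi b K n x y = ∫ σ in (0 : ℝ)..1,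
      K (trunc n (Real.digits x b + gridDigits b n ⌊σ * (b : ℝ) ^ n⌋₊))
        (trunc n (Real.digits y b + gridDigits b n ⌊σ * (b : ℝ) ^ n⌋₊)) := by
  have hfloor := integral_comp_floor_mul (Nat.pow_pos (n := n) (NeZero.pos b)) fun q =>
    K (trunc n (Real.digits x b + gridDigits b n q)) (trunc n (Real.digits y b + gridDigits b n q))
  rw [Nat.cast_pow] at hfloor
  exact hfloor.symm

theorem tendsto_gridDsi {K : ℝ → ℝ → ℝ} (hK : Continuous K.uncurry) {C : ℝ}
    (hC : ∀ x y, ‖K x y‖ ≤ C) (x y : ℝ) :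
    Tendsto (fun n => gridDsi b K n x y) atTop (𝓝 (dsi b K x y)) := by
  simp only [gridDsi_eq_integral, dsi]
  refine intervalIntegral.tendsto_integral_filter_of_dominated_convergence (fun _ => C)
    (Eventually.of_forall fun n => ?_)
    (Eventually.of_forall fun n => Eventually.of_forall fun σ _ => hC _ _) intervalIntegrable_const
    (Eventually.of_forall fun σ _ => ?_)
  · exact ((measurable_from_nat (f := fun q => K (trunc n (Real.digits x b + gridDigits b n q))
      (trunc n (Real.digits y b + gridDigits b n q)))).comp
      (Nat.measurable_floor.comp (measurable_id.mul_const _))).aestronglyMeasurable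
  · refine (tendsto_comp_trunc hK (Real.digits x b + Real.digits σ b)
      (Real.digits y b + Real.digits σ b)).congr fun n => ?_
    have hshift (z : ℝ) : trunc n (Real.digits z b + Real.digits σ b) =
        trunc n (Real.digits z b + gridDigits b n ⌊σ * (b : ℝ) ^ n⌋₊) :=
      trunc_congr fun j hj => by rw [Pi.add_apply, Pi.add_apply, digits_eq_gridDigits n σ hj]
    rw [hshift, hshift]

theorem quadForm_gridDsi (K : ℝ → ℝ → ℝ) (n : ℕ) (a : I →₀ ℝ) :
    quadForm (onI (gridDsi b K n)) a = ((b : ℝ) ^ n)⁻¹ * ∑ q ∈ Finset.range (b ^ n),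
      quadForm (fun x y : I => K (trunc n (Real.digits x b + gridDigits b n q))
        (trunc n (Real.digits y b + gridDigits b n q))) a := by
  rw [← quadForm_sum, ← quadForm_const_mul]
  rfl

theorem isSPSD_dsi {K : ℝ → ℝ → ℝ} (hK : Continuous K.uncurry) {C : ℝ} (hC : ∀ x y, ‖K x y‖ ≤ C)
    (hpos : (Matrix.of K).PosSemidef) : IsSPSD (dsi b K) := by
  refine posSemidef_iff_quadForm_nonneg.mpr ⟨fun x y => ?_, fun a => ?_⟩
  · simp only [onI, dsi, (posSemidef_iff_quadForm_nonneg.mp hpos).1 (digitAdd b x _)]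
  · refine ge_of_tendsto' (tendsto_quadForm (fun x y : I => tendsto_gridDsi hK hC x y) a)
      fun n => ?_
    refine (mul_nonneg (by positivity) (Finset.sum_nonneg fun q _ => ?_)).trans_eq
      (quadForm_gridDsi K n a).symm
    exact (posSemidef_iff_quadForm_nonneg.mp (hpos.submatrix fun x : I =>
      trunc n (Real.digits x b + gridDigits b n q))).2 a

theorem pairing_wal_add (hb : 2 ≤ b) (k : ℕ) (d : ℕ → Fin b) (a : I →₀ ℝ) :
    pairing a (fun x => wal b k (Real.digits x b + d)) = walshTransform b a k * wal b k d := by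
  simp only [walshTransform, pairing, wal_add hb, Finset.sum_mul, mul_assoc]

/- Parseval over the shifts removes the interaction of different Walsh frequencies. -/
theorem quadForm_gridDsi_korobov (hb : 2 ≤ b) {α : ℕ} (hα : 1 ≤ α) (n : ℕ) (a : I →₀ ℝ) :
    quadForm (onI (gridDsi b (korobov α) n)) a =
      ∑ k ∈ Finset.range (b ^ n), walshMass b α n k * ‖walshTransform b a k‖ ^ 2 := by
  have hbn : (b : ℝ) ^ n ≠ 0 := pow_ne_zero n (NeZero.ne _)
  have hmass : HasSum (fun h : ℤ => ∑ k ∈ Finset.range (b ^ n),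
      ((h : ℝ) ^ (2 * α))⁻¹ * ‖walshCoeff b n h k‖ ^ 2 * ‖walshTransform b a k‖ ^ 2)
      (∑ k ∈ Finset.range (b ^ n), walshMass b α n k * ‖walshTransform b a k‖ ^ 2) :=
    hasSum_sum fun k _ => (summable_walshMass hα n k).hasSum.mul_right _
  rw [quadForm_gridDsi]
  refine ((hasSum_sum fun q (_ : q ∈ Finset.range (b ^ n)) =>
    hasSum_quadForm_korobov hα _ a).mul_left _).unique (hmass.congr_fun fun h => ?_)
  simp only [pairing_e_mul_trunc hb, pairing_wal_add hb, ← mul_assoc]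
  rw [← Finset.mul_sum, sum_norm_sq_walsh_gridDigits hb n
    fun k => walshCoeff b n h k * walshTransform b a k, mul_left_comm,
    inv_mul_cancel_left₀ hbn, Finset.mul_sum]
  simp only [norm_mul, mul_pow, mul_assoc]

theorem exists_quadForm_dsi_korobov_le (hb : 2 ≤ b) {α : ℕ} (hα : 2 ≤ α) :
    ∃ C : ℝ, 0 ≤ C ∧
      ∀ a, quadForm (onI (dsi b (korobov α))) a ≤ C * quadForm (onI (kRing b α)) a := by
  have hα1 : 1 ≤ α := by omega
  obtain ⟨D, hD, hmass⟩ := exists_walshMass_le hb hα1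
  refine ⟨D, hD, fun a => ?_⟩
  set Q := quadForm (onI (kRing b α)) a
  have hleft := tendsto_quadForm (fun x y : I =>
    tendsto_gridDsi (b := b) (continuous_korobov hα1) (norm_korobov_le hα1) x y) a
  have hright : Tendsto (fun n => walshMass b α n 0 * ‖walshTransform b a 0‖ ^ 2 + D * Q) atTop
      (𝓝 (D * Q)) := by
    simpa using ((tendsto_walshMass_zero hb hα1).mul_const
      (‖walshTransform b a 0‖ ^ 2)).add_const (D * Q)
  refine le_of_tendsto_of_tendsto' hleft hright fun n => ?_
  have hterm : ∀ k ∈ Finset.Ico 1 (b ^ n), walshMass b α n k * ‖walshTransform b a k‖ ^ 2 ≤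
      D * (rRing2 b α k * ‖walshTransform b a k‖ ^ 2) := fun k hk => by
    obtain ⟨hk1, hkn⟩ := Finset.mem_Ico.mp hk
    rw [← mul_assoc]
    gcongr
    exact hmass n k (by omega) hkn
  calc quadForm (onI (gridDsi b (korobov α) n)) a
      = walshMass b α n 0 * ‖walshTransform b a 0‖ ^ 2 +
          ∑ k ∈ Finset.Ico 1 (b ^ n), walshMass b α n k * ‖walshTransform b a k‖ ^ 2 := by
        rw [quadForm_gridDsi_korobov hb hα1, Finset.range_eq_Ico,
          Finset.sum_eq_sum_Ico_succ_bot (Nat.pow_pos (NeZero.pos b))]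
    _ ≤ walshMass b α n 0 * ‖walshTransform b a 0‖ ^ 2 +
          D * ∑ k ∈ Finset.Ico 1 (b ^ n), rRing2 b α k * ‖walshTransform b a k‖ ^ 2 := by
        rw [Finset.mul_sum]
        exact add_le_add le_rfl (Finset.sum_le_sum hterm)
    _ ≤ walshMass b α n 0 * ‖walshTransform b a 0‖ ^ 2 + D * Q := by
        gcongr
        exact sum_Ico_le_quadForm_walshKernel hb (summable_rRing2 hb hα) (rRing2_nonneg b α) a _

end DigitalShift

end WalshRKHS

end

open WalshRKHS in
theorem mainTheorem3_general (b : ℕ) [NeZero b] (hb : 2 ≤ b) (α : ℕ) (hα : 2 ≤ α) :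
    (∀ x x' : I, HasSum (walshTerm b (rRing2 b α) x x') (kRing b α x x' : ℂ)) ∧
    (∀ x x' : I, HasSum (walshTerm b (rRingRing2 b α) x x') (kRingRing b α x x' : ℂ)) ∧
    IsSPSD (korobov α) ∧ IsSPSD (dsi b (korobov α)) ∧
    IsSPSD (kRing b α) ∧ IsSPSD (kRingRing b α) ∧
    H (dsi b (korobov α)) ⊆ H (kRing b α) ∧
    H (kRing b α) ⊆ H (kRingRing b α) ∧
    H (korobov α) ⊆ H (kRingRing b α) := by
  have hα1 : 1 ≤ α := by omega
  obtain ⟨C, hC, hdsi_le⟩ := exists_quadForm_dsi_korobov_le hb hα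
  obtain ⟨C', hC', hkorobov_le⟩ := exists_quadForm_korobov_le hb hα
  exact ⟨fun x x' => hasSum_walshTerm hb (summable_rRing2 hb hα) (rRing2_digitNeg hb α) x x',
    fun x x' => hasSum_walshTerm hb (summable_rRingRing2 hb hα) (rRingRing2_digitNeg hb α) x x',
    isSPSD_of_posSemidef (posSemidef_korobov hα1),
    isSPSD_dsi (continuous_korobov hα1) (norm_korobov_le hα1) (posSemidef_korobov hα1),
    isSPSD_kRing hb hα, isSPSD_kRingRing hb hα,
    rkhs_subset_of_quadForm_le (isSPSD_kRing hb hα) hC hdsi_le,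
    rkhs_subset_of_quadForm_le (isSPSD_kRingRing hb hα) zero_le_one fun a =>
      (quadForm_kRing_le hb hα a).trans_eq (one_mul _).symm,
    rkhs_subset_of_quadForm_le (isSPSD_kRingRing hb hα) hC' hkorobov_le⟩

open WalshRKHS in
theorem mainTheorem3 (b : ℕ) [Fact b.Prime] (α : ℕ) (hα : 2 ≤ α) :
    -- the two Walsh series converge, with real sums
    (∀ x x' : I, HasSum (walshTerm b (rRing2 b α) x x') (kRing b α x x' : ℂ)) ∧
    (∀ x x' : I, HasSum (walshTerm b (rRingRing2 b α) x x') (kRingRing b α x x' : ℂ)) ∧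
    -- all four kernels are symmetric positive semi-definite, hence have an RKHS
    IsSPSD (korobov α) ∧ IsSPSD (dsi b (korobov α)) ∧
    IsSPSD (kRing b α) ∧ IsSPSD (kRingRing b α) ∧
    -- the inclusions
    H (dsi b (korobov α)) ⊆ H (kRing b α) ∧
    H (kRing b α) ⊆ H (kRingRing b α) ∧
    H (korobov α) ⊆ H (kRingRing b α) :=
  mainTheorem3_general b (Fact.out : b.Prime).two_le α hα
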